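/- Let $Z,R,\varepsilon>0$ and $0<k_{\min}\le k_{\max}$. Let $H^2(0,Z)$ be the Sobolev space of real functions on $(0,Z)$ with the norm $\|u\|^2=\int_0^Z(u^2+u'^2+u''^2)\,dz$, and let $[\cdot,\cdot]$ and $\|\cdot\|$ also denote the scalar product and the norm of $H^2(0,Z)\times H^2(0,Z)$, so that $\|(q,r)\|^2=\|q\|^2+\|r\|^2$. For $k>0$ and $(q,r)\in H^2(0,Z)^2$ put $$L_1(q,r)=q''+\frac{2k}{\varepsilon}q'(q'-r')+\frac{1}{\varepsilon^2}(q'-r')^2-2\sqrt k\,q'-\frac{q'-r'}{\varepsilon\sqrt k},$$ $$L_2(q,r)=r''+\frac{2k}{\varepsilon}q'(q'-r')+\frac{1}{\varepsilon^2}(q'-r')^2-2\sqrt k\,q'-\frac{q'-r'}{\varepsilon\sqrt k},$$ and, for $\lambda>0$, $$J_\lambda(q,r)(k)=\int_0^Z\left[L_1(q,r)^2+L_2(q,r)^2\right]e^{-2\lambda z}\,dz .$$ For a real function $g$ that is differentiable at $k$, let $\overline{B(R)}=\overline{B(R)}(g,k)$ be the set of all pairs $(q,r)\in H^2(0,Z)^2$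 with $\|q\|+\|r\|\le R$ and $$q(0)=0,\quad q'(0)=2\sqrt k\,g'(k)+\frac{g(k)}{\sqrt k}-\frac{6}{k^{5/2}},\quad q'(Z)=0,$$ $$r(0)=-\varepsilon,\quad r'(0)=2\sqrt k\,(g'(k)-\varepsilon g(k))+\frac{g(k)}{\sqrt k}-\frac{6}{k^{5/2}}-\frac{4\varepsilon}{k^{3/2}},\quad r'(Z)=0 .$$ Let $V$ be the space of all $(u,v)\in H^2(0,Z)^2$ with $u(0)=u'(0)=u'(Z)=0$ and $v(0)=v'(0)=v'(Z)=0$. The Fréchet derivative of $J_\lambda(\cdot)(k)$ at $(q,r)$ is taken with respect to increments in $V$ and is identified with the element $J_\lambda'(q,r)(k)$ of $V$ that represents it in the scalar product $[\cdot,\cdot]$. **Theorem 5.1.** 1. For all $\lambda>0$, all $k>0$, all $g$ and all $(q,r)\in\overline{B(R)}$, the functional $J_\lambda(\cdot)(k)$ has at $(q,r)$ a (unique) Fréchet derivative $J_\lambda'(q,r)(k)\in V$. For every $\lambda>0$ there is a number $D>0$, which depends only on $R,\lambda,Z,\varepsilon,k_{\min},k_{\max}$, such that for all $k\in[k_{\min},k_{\max}]$,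 all $g$ and all $(q_1,r_1),(q_2,r_2)\in\overline{B(R)}$ $$\|J_\lambda'(q_2,r_2)(k)-J_\lambda'(q_1,r_1)(k)\|\le D\,\|(q_2,r_2)-(q_1,r_1)\| .$$ There are numbers $\lambda_1\ge 1$ and $C_1>0$, which depend only on $R,Z,k_{\min},k_{\max},\varepsilon$, such that the following holds for all $\lambda\ge\lambda_1$, all $k\in[k_{\min},k_{\max}]$ and all $g$. 2. For all $(q_1,r_1),(q_2,r_2)\in\overline{B(R)}$ $$J_\lambda(q_2,r_2)(k)-J_\lambda(q_1,r_1)(k)-\left[J_\lambda'(q_1,r_1)(k),(q_2-q_1,r_2-r_1)\right]\ge C_1e^{-2\lambda Z}\,\|(q_2,r_2)-(q_1,r_1)\|^2 .$$ 3. If $\overline{B(R)}$ is not empty, then $J_\lambda(\cdot)(k)$ has a unique minimizer $(q_{\min,\lambda},r_{\min,\lambda})$ on $\overline{B(R)}$, and $$\left[J_\lambda'(q_{\min,\lambda},r_{\min,\lambda})(k),(q-q_{\min,\lambda},r-r_{\min,\lambda})\right]\ge 0\qquad\text{for all }(q,r)\in\overline{B(R)} .$$ -/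

import Mathlib

open MeasureTheory Set
open scoped ContDiff

noncomputable section

namespace Convexification

/-- Lebesgue measure on the interval `(0, Z)`. -/
abbrev vol (Z : ℝ) : Measure ℝ := volume.restrict (Ioo 0 Z)

/-- The real Hilbert space `L²(0, Z)`. -/
abbrev L2 (Z : ℝ) : Type := Lp ℝ 2 (vol Z)

/-- `v` is the weak derivative of `u` on `(0, Z)`: `∫ u φ' = - ∫ v φ` for all `φ ∈ C_c^∞(0, Z)`. -/
def IsWeakDeriv (Z : ℝ) (u v : L2 Z) : Prop :=
  ∀ φ : ℝ → ℝ, ContDiff ℝ ∞ φ → HasCompactSupport φ → tsupport φ ⊆ Ioo 0 Z →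
    ∫ z in Ioo 0 Z, u z * deriv φ z = -∫ z in Ioo 0 Z, v z * φ z

theorem integrable_mul_test {Z : ℝ} (u : L2 Z) {φ : ℝ → ℝ} (hφ : Continuous φ)
    (hc : HasCompactSupport φ) : Integrable (fun z => u z * φ z) (vol Z) :=
  MemLp.integrable_mul (p := 2) (q := 2) (Lp.memLp u) (hφ.memLp_of_hasCompactSupport hc)

theorem IsWeakDeriv.zero (Z : ℝ) : IsWeakDeriv Z 0 0 := by
  intro φ _ _ _
  have h : ∀ ψ : ℝ → ℝ, ∫ z in Ioo 0 Z, (0 : L2 Z) z * ψ z = 0 := by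
    intro ψ
    apply integral_eq_zero_of_ae
    filter_upwards [Lp.coeFn_zero ℝ 2 (vol Z)] with z hz
    rw [hz, Pi.zero_apply, zero_mul]
  rw [h, h, neg_zero]

theorem IsWeakDeriv.add {Z : ℝ} {u v u' v' : L2 Z} (h : IsWeakDeriv Z u v)
    (h' : IsWeakDeriv Z u' v') : IsWeakDeriv Z (u + u') (v + v') := by
  intro φ hφ hc hs
  have hd : Continuous (deriv φ) := hφ.continuous_deriv (by simp)
  have key : ∀ (a b : L2 Z) (ψ : ℝ → ℝ), Continuous ψ → HasCompactSupport ψ →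
      ∫ z in Ioo 0 Z, (a + b : L2 Z) z * ψ z =
        (∫ z in Ioo 0 Z, a z * ψ z) + ∫ z in Ioo 0 Z, b z * ψ z := by
    intro a b ψ h1 h2
    rw [← integral_add (integrable_mul_test a h1 h2) (integrable_mul_test b h1 h2)]
    apply integral_congr_ae
    filter_upwards [Lp.coeFn_add a b] with z hz
    rw [hz, Pi.add_apply, add_mul]
  rw [key _ _ _ hd hc.deriv, key _ _ _ hφ.continuous hc, h φ hφ hc hs, h' φ hφ hc hs]
  ring

theorem IsWeakDeriv.smul {Z : ℝ} {u v : L2 Z} (c : ℝ) (h : IsWeakDeriv Z u v) :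
    IsWeakDeriv Z (c • u) (c • v) := by
  intro φ hφ hc hs
  have key : ∀ (a : L2 Z) (ψ : ℝ → ℝ),
      ∫ z in Ioo 0 Z, (c • a : L2 Z) z * ψ z = c * ∫ z in Ioo 0 Z, a z * ψ z := by
    intro a ψ
    rw [← integral_const_mul]
    apply integral_congr_ae
    filter_upwards [Lp.coeFn_smul c a] with z hz
    rw [hz, Pi.smul_apply, smul_eq_mul, mul_assoc]
  rw [key, key, h φ hφ hc hs]
  ring

/-- The triples `(u, u', u'')` of a function and its first two weak derivatives, all in
`L²(0, Z)`, as a subspace of the Hilbert space `L²(0, Z)³`. -/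
def H2Triples (Z : ℝ) : Submodule ℝ (PiLp 2 (fun _ : Fin 3 => L2 Z)) where
  carrier := {U | IsWeakDeriv Z (U 0) (U 1) ∧ IsWeakDeriv Z (U 1) (U 2)}
  zero_mem' := ⟨IsWeakDeriv.zero Z, IsWeakDeriv.zero Z⟩
  add_mem' h h' := ⟨h.1.add h'.1, h.2.add h'.2⟩
  smul_mem' c _ h := ⟨h.1.smul c, h.2.smul c⟩

/-- The Sobolev space `H²(0, Z)`. A function `u` is stored together with its first two weak
derivatives, so that the scalar product inherited from `L²(0, Z)³` is the usual one,
`∫ (u v + u' v' + u'' v'')`. -/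
def H2 (Z : ℝ) : Type := H2Triples Z

instance (Z : ℝ) : NormedAddCommGroup (H2 Z) :=
  inferInstanceAs (NormedAddCommGroup (H2Triples Z))

instance (Z : ℝ) : InnerProductSpace ℝ (H2 Z) :=
  inferInstanceAs (InnerProductSpace ℝ (H2Triples Z))

/-- The function `u` itself. -/
def d0 {Z : ℝ} (u : H2 Z) : L2 Z := u.1 0

/-- The weak derivative `u'`. -/
def d1 {Z : ℝ} (u : H2 Z) : L2 Z := u.1 1

/-- The second weak derivative `u''`. -/
def d2 {Z : ℝ} (u : H2 Z) : L2 Z := u.1 2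

/-- The value at the point `x ∈ [0, Z]` of (the continuous representative of) `w` is `a`. -/
def HasValueAt {Z : ℝ} (w : L2 Z) (x a : ℝ) : Prop :=
  ∃ f : ℝ → ℝ, ContinuousOn f (Icc 0 Z) ∧ f =ᵐ[vol Z] w ∧ f x = a

theorem HasValueAt.zero (Z x : ℝ) : HasValueAt (0 : L2 Z) x 0 :=
  ⟨fun _ => 0, continuousOn_const, (Lp.coeFn_zero ℝ 2 (vol Z)).symm, rfl⟩

theorem HasValueAt.add_zero {Z x : ℝ} {u v : L2 Z} (h : HasValueAt u x 0)
    (h' : HasValueAt v x 0) : HasValueAt (u + v) x 0 := by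
  obtain ⟨f, hf, hfu, hx⟩ := h
  obtain ⟨g, hg, hgv, hx'⟩ := h'
  exact ⟨f + g, hf.add hg, (hfu.add hgv).trans (Lp.coeFn_add u v).symm, by simp [hx, hx']⟩

theorem HasValueAt.smul_zero {Z x : ℝ} {u : L2 Z} (c : ℝ) (h : HasValueAt u x 0) :
    HasValueAt (c • u) x 0 := by
  obtain ⟨f, hf, hfu, hx⟩ := h
  exact ⟨c • f, hf.const_smul c, (hfu.const_smul c).trans (Lp.coeFn_smul c u).symm,
    by simp [hx]⟩

/-- The boundary conditions `u(0) = a`, `u'(0) = b`, `u'(Z) = c` for `u ∈ H²(0, Z)`. -/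
def BoundaryCond {Z : ℝ} (u : H2 Z) (a b c : ℝ) : Prop :=
  HasValueAt (d0 u) 0 a ∧ HasValueAt (d1 u) 0 b ∧ HasValueAt (d1 u) Z c

/-- The Hilbert space `H²(0, Z) × H²(0, Z)` with the scalar product
`[(q, r), (u, v)] = [q, u] + [r, v]`. -/
abbrev H2Pair (Z : ℝ) : Type := WithLp 2 (H2 Z × H2 Z)

/-- The subspace of the pairs `(u, v)` in `H²(0, Z) × H²(0, Z)` with
`u(0) = u'(0) = u'(Z) = 0` and `v(0) = v'(0) = v'(Z) = 0`. -/
def V (Z : ℝ) : Submodule ℝ (H2Pair Z) where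
  carrier := {h | BoundaryCond h.fst 0 0 0 ∧ BoundaryCond h.snd 0 0 0}
  zero_mem' := by
    have h : BoundaryCond (0 : H2 Z) 0 0 0 :=
      ⟨HasValueAt.zero Z 0, HasValueAt.zero Z 0, HasValueAt.zero Z Z⟩
    exact ⟨h, h⟩
  add_mem' := by
    have key : ∀ u v : H2 Z, BoundaryCond u 0 0 0 → BoundaryCond v 0 0 0 →
        BoundaryCond (u + v) 0 0 0 := fun u v h h' =>
      ⟨h.1.add_zero h'.1, h.2.1.add_zero h'.2.1, h.2.2.add_zero h'.2.2⟩
    exact fun {_ _} h h' => ⟨key _ _ h.1 h'.1, key _ _ h.2 h'.2⟩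
  smul_mem' := by
    have key : ∀ (c : ℝ) (u : H2 Z), BoundaryCond u 0 0 0 → BoundaryCond (c • u) 0 0 0 :=
      fun c u h => ⟨h.1.smul_zero c, h.2.1.smul_zero c, h.2.2.smul_zero c⟩
    exact fun c _ h => ⟨key c _ h.1, key c _ h.2⟩

/-- The lower order part shared by the two operators:
`2 (k/ε) q' (q' - r') + (q' - r')² / ε² - 2 √k q' - (q' - r') / (ε √k)`. -/
def lowerOrder {Z : ℝ} (ε k : ℝ) (x : H2Pair Z) (z : ℝ) : ℝ :=
  2 * (k / ε) * d1 x.fst z * (d1 x.fst z - d1 x.snd z)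
    + 1 / ε ^ 2 * (d1 x.fst z - d1 x.snd z) ^ 2
    - 2 * √k * d1 x.fst z - (d1 x.fst z - d1 x.snd z) / (ε * √k)

/-- `L₁(q, r) = q'' + 2 (k/ε) q' (q' - r') + (q' - r')² / ε² - 2 √k q' - (q' - r') / (ε √k)`. -/
def L₁ {Z : ℝ} (ε k : ℝ) (x : H2Pair Z) (z : ℝ) : ℝ := d2 x.fst z + lowerOrder ε k x z

/-- `L₂(q, r) = r'' + 2 (k/ε) q' (q' - r') + (q' - r')² / ε² - 2 √k q' - (q' - r') / (ε √k)`. -/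
def L₂ {Z : ℝ} (ε k : ℝ) (x : H2Pair Z) (z : ℝ) : ℝ := d2 x.snd z + lowerOrder ε k x z

/-- The weighted functional `J_λ(q, r)(k) = ∫₀^Z (L₁² + L₂²) e^{-2λz} dz`. -/
def J {Z : ℝ} (ε lam k : ℝ) (x : H2Pair Z) : ℝ :=
  ∫ z in Ioo 0 Z, ((L₁ ε k x z) ^ 2 + (L₂ ε k x z) ^ 2) * Real.exp (-2 * lam * z)

/-- The section at `k` of the closed set `B(R)`: the pairs `(q, r)` in `H²(0, Z) × H²(0, Z)` with
`‖q‖ + ‖r‖ ≤ R` that satisfy the boundary conditions determined by the data `g`. -/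
def B (Z ε R : ℝ) (g : ℝ → ℝ) (k : ℝ) : Set (H2Pair Z) :=
  {x | ‖x.fst‖ + ‖x.snd‖ ≤ R ∧
    BoundaryCond x.fst 0 (2 * √k * deriv g k + g k / √k - 6 / k ^ (5 / 2 : ℝ)) 0 ∧
    BoundaryCond x.snd (-ε)
      (2 * √k * (deriv g k - ε * g k) + g k / √k - 6 / k ^ (5 / 2 : ℝ)
        - 4 * ε / k ^ (3 / 2 : ℝ)) 0}

/-- `G ∈ V` is the Fréchet derivative of `J_λ(·)(k)` at `x = (q, r)`: the increments range over
the space `V` of pairs with zero boundary conditions (so that `x + h` meets the same boundary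
conditions as `x`), and the derivative, a bounded linear functional on `V`, is identified with
the element `G` of `V` that represents it in the scalar product of `H²(0, Z) × H²(0, Z)`. -/
def IsFrechetDeriv {Z : ℝ} (ε lam k : ℝ) (x : H2Pair Z) (G : V Z) : Prop :=
  HasFDerivAt (fun h : V Z => J ε lam k (x + (h : H2Pair Z))) (innerSL ℝ G) 0

end Convexification

end

open Convexification

noncomputable section

namespace Convexification

/-! Let `W` be multiplication by `e^{-λz}`. By `J_eq`, the functional is a sum of two terms
`‖F(x)‖²`, where `F(x) = S x + N(x, x)` takes values in `L²`, with `S` linear and `N` bilinear;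
products of first derivatives lie in `L²` because `H²` embeds into functions with bounded
derivative. Hence `J` is a polynomial on a Hilbert space: it is differentiable everywhere, its
derivative is Lipschitz on balls, and the Riesz theorem on the closed subspace `V` gives the
gradient.

For strong convexity the expansion is exact (`normSq_quadMap_add`): the remainder at an increment
`h` is `‖F'(x)h + N(h, h)‖² + 2⟨F(x), N(h, h)⟩`. The leading part of the square is the weighted
second derivative of a component of `h`; everything else contains a first derivative of `h`, which
vanishes at `0`. The Carleman estimate `IsWeakDeriv.ae_abs_W_le` bounds a weighted first derivative
in the supremum norm by `(2λ)^{-1/2}` times the weighted `L²` norm of the second. So the square of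
the lower order part is `O(1/λ)` relative to the leading term. In the inner product both weights are
moved onto `N(h, h)`, one for each factor, which again gives `O(1/λ)` (`norm_W_W_quadPart_le`). For
large `λ` all of this is absorbed (`remainder_ge`, `strong_convexity`), and Poincaré's inequality
together with `e^{-λz} ≥ e^{-λZ}` yields the full `H²` norm.

Since `B` is closed and convex, strong convexity at midpoints makes minimizing sequences Cauchy
(`exists_isMinOn_of_midpoint`); the variational inequality is the first order condition at the
minimizer. -/

/-! ### Weak derivatives and primitives. -/

theorem exists_Icc_of_isCompact {Z : ℝ} (hZ : 0 < Z) {K : Set ℝ} (hK : IsCompact K)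
    (hs : K ⊆ Ioo 0 Z) : ∃ a b : ℝ, 0 < a ∧ b < Z ∧ K ⊆ Icc a b := by
  rcases K.eq_empty_or_nonempty with rfl | hne
  · exact ⟨Z / 2, Z / 2, by linarith, by linarith, empty_subset _⟩
  · obtain ⟨a, ha⟩ := hK.exists_isLeast hne
    obtain ⟨b, hb⟩ := hK.exists_isGreatest hne
    exact ⟨a, b, (hs ha.1).1, (hs hb.1).2, fun x hx => ⟨ha.2 hx, hb.2 hx⟩⟩

/-- A test function on `(0, Z)` with vanishing integral is the derivative of a test function. -/
theorem exists_test_deriv_eq {Z : ℝ} (hZ : 0 < Z) {χ : ℝ → ℝ} (hχ : ContDiff ℝ ∞ χ)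
    (hc : HasCompactSupport χ) (hs : tsupport χ ⊆ Ioo 0 Z) (h0 : ∫ z in Ioo 0 Z, χ z = 0) :
    ∃ φ : ℝ → ℝ, ContDiff ℝ ∞ φ ∧ HasCompactSupport φ ∧ tsupport φ ⊆ Ioo 0 Z ∧
      deriv φ = χ := by
  obtain ⟨a, b, ha, hb, hab⟩ := exists_Icc_of_isCompact hZ hc hs
  have hz : ∀ x, x ∉ Icc a b → χ x = 0 := fun x hx =>
    image_eq_zero_of_notMem_tsupport fun h => hx (hab h)
  have hd : ∀ x, HasDerivAt (fun z => ∫ t in (0 : ℝ)..z, χ t) (χ x) x := fun x =>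
    intervalIntegral.integral_hasDerivAt_right (hχ.continuous.intervalIntegrable _ _)
      (hχ.continuous.stronglyMeasurableAtFilter _ _) hχ.continuous.continuousAt
  have hderiv : deriv (fun z => ∫ t in (0 : ℝ)..z, χ t) = χ := funext fun x => (hd x).deriv
  have hsupp : Function.support (fun z => ∫ t in (0 : ℝ)..z, χ t) ⊆ Icc a b := by
    intro x hx
    by_contra hxab
    apply hx
    simp only
    rcases lt_or_ge x a with h | h
    · rw [intervalIntegral.integral_zero_ae]
      refine Filter.Eventually.of_forall fun t ht => hz t fun h' => ?_
      have := ht.2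
      have h1 := h'.1
      rcases le_max_iff.1 this with h2 | h2 <;> linarith
    · have hbx : b < x := by
        by_contra hcon
        exact hxab ⟨h, not_lt.1 hcon⟩
      -- The integral from `0` to `x` is split at `Z`, where the vanishing mean applies. Since `b`
      -- lies below both `Z` and `x`, nothing is left between these two, in whichever order they
      -- come.
      have e1 : ∫ t in (0 : ℝ)..Z, χ t = 0 := by
        rw [intervalIntegral.integral_of_le hZ.le, integral_Ioc_eq_integral_Ioo, h0]
      have e2 : ∫ t in Z..x, χ t = 0 := by
        rw [intervalIntegral.integral_zero_ae]
        refine Filter.Eventually.of_forall fun t ht => hz t fun h' => ?_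
        have := ht.1
        have h1 := h'.2
        rcases min_lt_iff.1 this with h2 | h2 <;> linarith
      rw [← intervalIntegral.integral_add_adjacent_intervals
        (hχ.continuous.intervalIntegrable 0 Z) (hχ.continuous.intervalIntegrable Z x), e1, e2,
        add_zero]
  have htsupp : tsupport (fun z => ∫ t in (0 : ℝ)..z, χ t) ⊆ Icc a b :=
    closure_minimal hsupp isClosed_Icc
  refine ⟨_, ?_, isCompact_Icc.of_isClosed_subset (isClosed_tsupport _) htsupp,
    htsupp.trans fun x hx => ⟨ha.trans_le hx.1, hx.2.trans_lt hb⟩, hderiv⟩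
  rw [contDiff_infty_iff_deriv, hderiv]
  exact ⟨fun x => (hd x).differentiableAt, hχ⟩

theorem L2.integrable {Z : ℝ} (v : L2 Z) : Integrable v (vol Z) :=
  (Lp.memLp v).integrable (by norm_num)

theorem L2.intervalIntegrable {Z : ℝ} (hZ : 0 < Z) (v : L2 Z) :
    IntervalIntegrable v volume 0 Z := by
  rw [intervalIntegrable_iff_integrableOn_Ioo_of_le hZ.le]
  exact L2.integrable v

/-- The primitive of `v` with value `c` at `0`. -/
def primitive {Z : ℝ} (c : ℝ) (v : L2 Z) (z : ℝ) : ℝ := c + ∫ t in (0 : ℝ)..z, v t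

theorem primitive_continuousOn {Z : ℝ} (hZ : 0 < Z) (c : ℝ) (v : L2 Z) :
    ContinuousOn (primitive c v) (Icc 0 Z) := by
  have h := intervalIntegral.continuousOn_primitive_interval
    (μ := volume) (f := v) (a := 0) (b := Z) ?_
  · rw [uIcc_of_le hZ.le] at h
    exact continuousOn_const.add h
  · exact (intervalIntegrable_iff' (by simp)).1 (L2.intervalIntegrable hZ v)

/-- Integration by parts for absolutely continuous functions: the primitive has derivative `v`
almost everywhere, and `φ` vanishes at both endpoints. -/
theorem integral_primitive_mul_deriv {Z : ℝ} (hZ : 0 < Z) (v : L2 Z) {φ : ℝ → ℝ}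
    (hφ : ContDiff ℝ ∞ φ) (hs : tsupport φ ⊆ Ioo 0 Z) :
    ∫ z in Ioo 0 Z, primitive 0 v z * deriv φ z = -∫ z in Ioo 0 Z, v z * φ z := by
  have hi := L2.intervalIntegrable hZ v
  have hac := hi.absolutelyContinuousOnInterval_intervalIntegral (c := 0) (by simp)
  have hφac : AbsolutelyContinuousOnInterval φ 0 Z :=
    (hφ.of_le (by simp)).contDiffOn.absolutelyContinuousOnInterval
  have h := hac.integral_mul_deriv_eq_deriv_mul hφac
  have hφ0 : ∀ x, x ∉ Ioo 0 Z → φ x = 0 := fun x hx =>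
    image_eq_zero_of_notMem_tsupport fun h => hx (hs h)
  rw [hφ0 0 (by simp), hφ0 Z (by simp)] at h
  have hder : ∫ x in (0 : ℝ)..Z, deriv (fun x => ∫ t in (0 : ℝ)..x, v t) x * φ x
      = ∫ x in (0 : ℝ)..Z, v x * φ x := by
    apply intervalIntegral.integral_congr_ae
    filter_upwards [hi.ae_hasDerivAt_integral] with x hx hx'
    rw [(hx (uIoc_subset_uIcc hx') 0 (by simp)).deriv]
  have hIoo : ∀ f : ℝ → ℝ, ∫ x in (0 : ℝ)..Z, f x = ∫ x in Ioo 0 Z, f x := fun f => by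
    rw [intervalIntegral.integral_of_le hZ.le, integral_Ioc_eq_integral_Ioo]
  rw [hder] at h
  simp only [mul_zero, sub_zero, zero_sub, hIoo] at h
  simpa only [primitive, zero_add] using h

theorem exists_test_integral_one {Z : ℝ} (hZ : 0 < Z) : ∃ η : ℝ → ℝ, ContDiff ℝ ∞ η ∧
    HasCompactSupport η ∧ tsupport η ⊆ Ioo 0 Z ∧ ∫ z in Ioo 0 Z, η z = 1 := by
  let f : ContDiffBump (Z / 2) := ⟨Z / 8, Z / 4, by linarith, by linarith⟩
  have hs : tsupport (f.normed volume) ⊆ Ioo 0 Z := by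
    rw [f.tsupport_normed_eq, Real.closedBall_eq_Icc]
    intro x hx
    have h1 : f.rOut = Z / 4 := rfl
    rw [h1] at hx
    exact ⟨by linarith [hx.1], by linarith [hx.2]⟩
  refine ⟨f.normed volume, f.contDiff_normed, f.hasCompactSupport_normed, hs, ?_⟩
  rw [setIntegral_eq_integral_of_forall_compl_eq_zero, f.integral_normed]
  exact fun x hx => image_eq_zero_of_notMem_tsupport fun h => hx (hs h)

/-- Du Bois-Reymond: a function on `(0, Z)` with vanishing weak derivative is constant. -/
theorem ae_const_of_integral_mul_deriv_eq_zero {Z : ℝ} (hZ : 0 < Z) {w : ℝ → ℝ}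
    (hw : Integrable w (vol Z))
    (h : ∀ φ : ℝ → ℝ, ContDiff ℝ ∞ φ → HasCompactSupport φ → tsupport φ ⊆ Ioo 0 Z →
      ∫ z in Ioo 0 Z, w z * deriv φ z = 0) : ∃ c, ∀ᵐ z ∂vol Z, w z = c := by
  obtain ⟨η, hη, hηc, hηs, hη1⟩ := exists_test_integral_one hZ
  have hint : ∀ {ψ : ℝ → ℝ}, Continuous ψ → HasCompactSupport ψ →
      Integrable (fun z => w z * ψ z) (vol Z) := by
    intro ψ hψ hψc
    obtain ⟨C, hC⟩ := hψc.exists_bound_of_continuous hψ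
    exact hw.mul_bdd (c := C) hψ.aestronglyMeasurable (Filter.Eventually.of_forall hC)
  refine ⟨∫ z in Ioo 0 Z, w z * η z, ?_⟩
  set c := ∫ z in Ioo 0 Z, w z * η z
  have key := isOpen_Ioo.ae_eq_zero_of_integral_contDiff_smul_eq_zero (μ := volume)
    (U := Ioo 0 Z) (f := fun z => w z - c) ?_ ?_
  · rw [ae_restrict_iff' measurableSet_Ioo]
    filter_upwards [key] with z hz hz'
    linarith [hz hz']
  · have : Integrable (fun z => w z - c) (vol Z) := hw.sub (integrable_const c)
    exact IntegrableOn.locallyIntegrableOn this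
  · intro ψ hψ hψc hψs
    set b := ∫ z in Ioo 0 Z, ψ z
    have hψi : Integrable ψ (vol Z) := (hψ.continuous.integrable_of_hasCompactSupport hψc).restrict
    have hηi : Integrable η (vol Z) := (hη.continuous.integrable_of_hasCompactSupport hηc).restrict
    -- Subtracting `b * η` removes the mean of `ψ`, so the difference is the derivative of a test
    -- function and `w` annihilates it.
    obtain ⟨φ, hφ, hφc, hφs, hφd⟩ := exists_test_deriv_eq hZ
      (χ := fun z => ψ z - b * η z) (hψ.sub (contDiff_const.mul hη))
      (hψc.sub (hηc.mul_left (f := fun _ => b)))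
      ((tsupport_sub _ _).trans (union_subset hψs
        ((closure_mono (Function.support_mul_subset_right (fun _ => b) η)).trans hηs)))
      (by rw [integral_sub hψi (hηi.const_mul b), integral_const_mul, hη1, mul_one, sub_self])
    have h1 := h φ hφ hφc hφs
    have h2 : ∫ z in Ioo 0 Z, w z * deriv φ z = (∫ z in Ioo 0 Z, w z * ψ z) - b * c := by
      rw [hφd, ← integral_const_mul, ← integral_sub (hint hψ.continuous hψc)
        ((hint hη.continuous hηc).const_mul b)]
      congr 1
      ext z
      ring
    have h3 : ∫ x, ψ x • (w x - c) = ∫ x in Ioo 0 Z, ψ x • (w x - c) := by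
      rw [setIntegral_eq_integral_of_forall_compl_eq_zero]
      intro x hx
      rw [image_eq_zero_of_notMem_tsupport fun h => hx (hψs h), zero_smul]
    have h4 : ∫ x in Ioo 0 Z, ψ x • (w x - c) = (∫ z in Ioo 0 Z, w z * ψ z) - b * c := by
      rw [mul_comm b c, ← integral_const_mul, ← integral_sub (hint hψ.continuous hψc)
        (hψi.const_mul c)]
      congr 1
      ext z
      rw [smul_eq_mul]
      ring
    rw [h3, h4, ← h2, h1]

/-- A function with a weak derivative is almost everywhere the primitive of that derivative. -/
theorem IsWeakDeriv.exists_primitive {Z : ℝ} (hZ : 0 < Z) {u v : L2 Z} (h : IsWeakDeriv Z u v) :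
    ∃ c, u =ᵐ[vol Z] primitive c v := by
  have hp : Integrable (primitive 0 v) (vol Z) :=
    ((primitive_continuousOn hZ 0 v).integrableOn_Icc).mono_set Ioo_subset_Icc_self
  obtain ⟨c, hc⟩ := ae_const_of_integral_mul_deriv_eq_zero hZ
    (w := fun z => u z - primitive 0 v z) ((L2.integrable u).sub hp) (by
      intro φ hφ hφc hφs
      have hd : Continuous (deriv φ) := hφ.continuous_deriv (by simp)
      obtain ⟨C, hC⟩ := hφc.deriv.exists_bound_of_continuous hd
      have h1 : Integrable (fun z => primitive 0 v z * deriv φ z) (vol Z) :=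
        hp.mul_bdd (c := C) hd.aestronglyMeasurable (Filter.Eventually.of_forall hC)
      simp_rw [sub_mul]
      rw [integral_sub (integrable_mul_test u hd hφc.deriv) h1, h φ hφ hφc hφs,
        integral_primitive_mul_deriv hZ v hφ hφs, sub_self])
  refine ⟨c, ?_⟩
  filter_upwards [hc] with z hz
  simp only [primitive] at hz ⊢
  linarith

/-! ### Multiplication by the exponential weight on `L²`. -/

theorem L2.norm_sq_eq {Z : ℝ} (f : L2 Z) : ‖f‖ ^ 2 = ∫ z in Ioo 0 Z, f z ^ 2 := by
  rw [← real_inner_self_eq_norm_sq, L2.inner_def]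
  congr 1
  ext z
  simp [pow_two]

theorem L2.norm_le_of_ae_bound {Z : ℝ} (hZ : 0 < Z) {f : L2 Z} {C : ℝ} (hC : 0 ≤ C)
    (h : ∀ᵐ z ∂vol Z, |f z| ≤ C) : ‖f‖ ≤ √Z * C := by
  rw [← abs_of_nonneg (norm_nonneg f), ← abs_of_nonneg (mul_nonneg (Real.sqrt_nonneg Z) hC),
    ← sq_le_sq, mul_pow, Real.sq_sqrt hZ.le, L2.norm_sq_eq]
  have h1 : ∫ _ in Ioo 0 Z, C ^ 2 = Z * C ^ 2 := by simp [hZ.le]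
  rw [← h1]
  refine integral_mono_ae (Lp.memLp f).integrable_sq (integrable_const _) ?_
  filter_upwards [h] with z hz
  exact sq_le_sq' (abs_le.1 hz).1 (abs_le.1 hz).2

/-- The pointwise product of a bounded function and a square integrable function. -/
def mulInf (Z : ℝ) : Lp ℝ ⊤ (vol Z) →L[ℝ] L2 Z →L[ℝ] L2 Z :=
  (ContinuousLinearMap.mul ℝ ℝ).holderL (vol Z) ⊤ 2 2

theorem coeFn_mulInf {Z : ℝ} (f : Lp ℝ ⊤ (vol Z)) (g : L2 Z) :
    mulInf Z f g =ᵐ[vol Z] fun z => f z * g z :=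
  (ContinuousLinearMap.mul ℝ ℝ).coeFn_holder f g

theorem norm_mulInf_apply_le {Z : ℝ} (f : Lp ℝ ⊤ (vol Z)) (g : L2 Z) :
    ‖mulInf Z f g‖ ≤ ‖f‖ * ‖g‖ := by
  have h := (ContinuousLinearMap.mul ℝ ℝ).norm_holder_apply_apply_le (r := 2) f g
  rw [ContinuousLinearMap.opNorm_mul, one_mul] at h
  exact h

theorem abs_exp_le {Z lam z : ℝ} (hz : z ∈ Ioo 0 Z) :
    ‖Real.exp (-lam * z)‖ ≤ Real.exp (|lam| * Z) := by
  rw [Real.norm_eq_abs, Real.abs_exp]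
  apply Real.exp_le_exp.2
  have h1 := neg_abs_le lam
  have h2 := abs_nonneg lam
  nlinarith [hz.1, hz.2]

/-- The weight `e^{-λz}` as a bounded function on `(0, Z)`. -/
def weight (Z lam : ℝ) : Lp ℝ ⊤ (vol Z) :=
  (memLp_top_of_bound (μ := vol Z) (f := fun z => Real.exp (-lam * z))
    (by fun_prop : Continuous fun z => Real.exp (-lam * z)).aestronglyMeasurable
    (Real.exp (|lam| * Z))
    ((ae_restrict_mem measurableSet_Ioo).mono fun _ hz => abs_exp_le hz)).toLp _

/-- Multiplication by `e^{-λz}` on `L²(0, Z)`. -/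
def W (Z lam : ℝ) : L2 Z →L[ℝ] L2 Z := mulInf Z (weight Z lam)

theorem coeFn_W {Z : ℝ} (lam : ℝ) (f : L2 Z) :
    W Z lam f =ᵐ[vol Z] fun z => Real.exp (-lam * z) * f z := by
  filter_upwards [coeFn_mulInf (weight Z lam) f, MemLp.coeFn_toLp (memLp_top_of_bound (μ := vol Z)
    (f := fun z => Real.exp (-lam * z))
    (by fun_prop : Continuous fun z => Real.exp (-lam * z)).aestronglyMeasurable
    (Real.exp (|lam| * Z))
    ((ae_restrict_mem measurableSet_Ioo).mono fun _ hz => abs_exp_le hz))] with z h1 h2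
  rw [W, h1, weight, h2]

theorem W_zero {Z : ℝ} (f : L2 Z) : W Z 0 f = f := by
  apply Lp.ext
  filter_upwards [coeFn_W 0 f] with z hz
  simp [hz]

theorem norm_W_le {Z lam : ℝ} (hl : 0 ≤ lam) (f : L2 Z) : ‖W Z lam f‖ ≤ ‖f‖ := by
  apply Lp.norm_le_norm_of_ae_le
  filter_upwards [coeFn_W lam f, ae_restrict_mem measurableSet_Ioo] with z hz hz'
  rw [hz, norm_mul, Real.norm_eq_abs, Real.abs_exp]
  apply mul_le_of_le_one_left (norm_nonneg _)
  rw [Real.exp_le_one_iff]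
  nlinarith [hz'.1]

theorem exp_mul_norm_le_norm_W {Z lam : ℝ} (hl : 0 ≤ lam) (f : L2 Z) :
    Real.exp (-lam * Z) * ‖f‖ ≤ ‖W Z lam f‖ := by
  have h : ‖f‖ ≤ Real.exp (lam * Z) * ‖W Z lam f‖ := by
    apply Lp.norm_le_mul_norm_of_ae_le_mul
    filter_upwards [coeFn_W lam f, ae_restrict_mem measurableSet_Ioo] with z hz hz'
    rw [hz, norm_mul, Real.norm_eq_abs, Real.norm_eq_abs, Real.abs_exp, ← mul_assoc,
      ← Real.exp_add]
    apply le_mul_of_one_le_left (abs_nonneg _)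
    rw [Real.one_le_exp_iff]
    nlinarith [hz'.2]
  calc _ ≤ Real.exp (-lam * Z) * (Real.exp (lam * Z) * ‖W Z lam f‖) := by gcongr
    _ = _ := by rw [← mul_assoc, ← Real.exp_add]; simp

/-- Multiplication by a real weight is self-adjoint; this is what lets both weights fall on the
quadratic term. -/
theorem inner_W_W {Z lam : ℝ} (f g : L2 Z) :
    inner ℝ (W Z lam f) (W Z lam g) = inner ℝ f (W Z lam (W Z lam g)) := by
  rw [L2.inner_def, L2.inner_def]
  apply integral_congr_ae
  filter_upwards [coeFn_W lam f, coeFn_W lam g, coeFn_W lam (W Z lam g)] with z h1 h2 h3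
  rw [h1, h3, h2]
  simp only [RCLike.inner_apply, conj_trivial]
  ring

/-! ### Weighted bounds for primitives, boundary values and Sobolev embedding. -/

/-- Cauchy-Schwarz for a weighted primitive. -/
theorem exp_mul_abs_integral_le {Z lam x K : ℝ} (hx : x ∈ Icc 0 Z)
    (hK : ∫ t in Ioo 0 x, Real.exp (-lam * (x - t)) ^ 2 ≤ K) (v : L2 Z) :
    Real.exp (-lam * x) * |∫ t in (0 : ℝ)..x, v t| ≤ √K * ‖W Z lam v‖ := by
  have hsub : Ioo 0 x ⊆ Ioo 0 Z := Ioo_subset_Ioo_right hx.2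
  have hle : volume.restrict (Ioo 0 x) ≤ vol Z := Measure.restrict_mono hsub le_rfl
  have hE : MemLp (fun t => Real.exp (-lam * (x - t))) 2 (volume.restrict (Ioo 0 x)) := by
    refine MemLp.of_bound (by fun_prop :
      Continuous fun t => Real.exp (-lam * (x - t))).aestronglyMeasurable
      (Real.exp (|lam| * Z)) ((ae_restrict_mem measurableSet_Ioo).mono fun t ht =>
        abs_exp_le (z := x - t) ⟨by linarith [ht.2], by linarith [ht.1, hx.2]⟩)
  have hW : MemLp (W Z lam v) 2 (volume.restrict (Ioo 0 x)) :=
    (Lp.memLp _).mono_measure hle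
  have hWv : ∀ᵐ t ∂volume.restrict (Ioo 0 x), W Z lam v t = Real.exp (-lam * t) * v t :=
    ae_mono hle (coeFn_W lam v)
  -- The weight at `x` factors as the weight at `t`, which turns `v` into `W v`, times the kernel
  -- `e^{-λ(x-t)}`. For positive `λ` the kernel decays away from `x`, and its squared `L²` norm is
  -- at most `1/(2λ)`.
  have h1 : Real.exp (-lam * x) * ∫ t in (0 : ℝ)..x, v t
      = ∫ t in Ioo 0 x, Real.exp (-lam * (x - t)) * W Z lam v t := by
    rw [intervalIntegral.integral_of_le hx.1, integral_Ioc_eq_integral_Ioo, ← integral_const_mul]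
    apply integral_congr_ae
    filter_upwards [hWv] with t ht
    rw [ht, ← mul_assoc, ← Real.exp_add]
    congr 2
    ring
  have h2 := integral_mul_norm_le_Lp_mul_Lq (μ := volume.restrict (Ioo 0 x))
    Real.HolderConjugate.two_two
    (f := fun t => Real.exp (-lam * (x - t))) (g := W Z lam v)
    (by simpa using hE) (by simpa using hW)
  simp only [← Real.sqrt_eq_rpow, Real.rpow_two, Real.norm_eq_abs, sq_abs] at h2
  have h3 : ∫ t in Ioo 0 x, (W Z lam v t) ^ 2 ≤ ‖W Z lam v‖ ^ 2 := by
    rw [L2.norm_sq_eq]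
    exact setIntegral_mono_set (Lp.memLp _).integrable_sq
      (Filter.Eventually.of_forall fun _ => sq_nonneg _) hsub.eventuallyLE
  calc Real.exp (-lam * x) * |∫ t in (0 : ℝ)..x, v t|
      = |∫ t in Ioo 0 x, Real.exp (-lam * (x - t)) * W Z lam v t| := by
        rw [← h1, abs_mul, Real.abs_exp]
    _ ≤ ∫ t in Ioo 0 x, |Real.exp (-lam * (x - t))| * |W Z lam v t| := by
        refine (abs_integral_le_integral_abs).trans_eq ?_
        simp_rw [abs_mul]
    _ ≤ _ := h2
    _ ≤ √K * √(‖W Z lam v‖ ^ 2) := by gcongr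
    _ = _ := by rw [Real.sqrt_sq (norm_nonneg _)]

theorem integral_exp_sq_le {lam x : ℝ} (hl : 0 < lam) (hx : 0 ≤ x) :
    ∫ t in Ioo 0 x, Real.exp (-lam * (x - t)) ^ 2 ≤ 1 / (2 * lam) := by
  have hd : ∀ t ∈ uIcc 0 x, HasDerivAt (fun t => 1 / (2 * lam) * Real.exp (-lam * (x - t)) ^ 2)
      (Real.exp (-lam * (x - t)) ^ 2) t := by
    intro t _
    have h := (((((hasDerivAt_id t).const_sub x).const_mul (-lam)).exp).pow 2).const_mul
      (1 / (2 * lam))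
    convert! h using 1
    simp only [id]
    field_simp
    norm_num
    ring
  have h := intervalIntegral.integral_eq_sub_of_hasDerivAt hd
    ((by fun_prop : Continuous fun t => Real.exp (-lam * (x - t)) ^ 2).intervalIntegrable _ _)
  rw [intervalIntegral.integral_of_le hx, integral_Ioc_eq_integral_Ioo] at h
  rw [h]
  have h2 : 0 ≤ 1 / (2 * lam) * Real.exp (-lam * (x - 0)) ^ 2 := by positivity
  simp only [sub_self, mul_zero, Real.exp_zero, one_pow, mul_one] at h2 ⊢
  linarith

/-- The case `lam = 0`: the kernel is `1` and its squared norm is at most `Z`. -/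
theorem abs_integral_le {Z x : ℝ} (hx : x ∈ Icc 0 Z) (v : L2 Z) :
    |∫ t in (0 : ℝ)..x, v t| ≤ √Z * ‖v‖ := by
  have h := exp_mul_abs_integral_le (lam := 0) (K := Z) hx (by simpa [hx.1] using hx.2) v
  simpa [W_zero] using h

theorem exp_mul_abs_integral_le' {Z lam x : ℝ} (hl : 0 < lam) (hx : x ∈ Icc 0 Z) (v : L2 Z) :
    Real.exp (-lam * x) * |∫ t in (0 : ℝ)..x, v t| ≤ √(1 / (2 * lam)) * ‖W Z lam v‖ :=
  exp_mul_abs_integral_le hx (integral_exp_sq_le hl hx.1) v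

/-- The constant of the embedding of `H¹(0, Z)` into the continuous functions. -/
def sobolevConst (Z : ℝ) : ℝ := 1 / √Z + 2 * √Z

theorem sobolevConst_nonneg (Z : ℝ) : 0 ≤ sobolevConst Z := by
  unfold sobolevConst; positivity

/-- The initial value `c` is controlled by comparing the constant function `c` with `u` in `L²`:
their difference is an integral of `v`, uniformly bounded by `√Z * ‖v‖`. -/
theorem abs_primitive_le {Z c : ℝ} (hZ : 0 < Z) {u v : L2 Z} (h : u =ᵐ[vol Z] primitive c v)
    {x : ℝ} (hx : x ∈ Icc 0 Z) : |primitive c v x| ≤ sobolevConst Z * (‖u‖ + ‖v‖) := by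
  have hs := Real.sqrt_pos.2 hZ
  have hc : |c| * √Z ≤ ‖u‖ + √Z * (√Z * ‖v‖) := by
    obtain ⟨w, hw⟩ : ∃ w : L2 Z, w =ᵐ[vol Z] fun _ => c :=
      ⟨(memLp_const c).toLp _, (memLp_const c).coeFn_toLp⟩
    have e1 : ‖w‖ = |c| * √Z := by
      rw [← Real.sqrt_sq (norm_nonneg w), L2.norm_sq_eq]
      have : ∫ z in Ioo 0 Z, w z ^ 2 = Z * c ^ 2 := by
        rw [integral_congr_ae (g := fun _ => c ^ 2) (hw.mono fun z hz => by
          simp only [hz])]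
        simp [hZ.le]
      rw [this, Real.sqrt_mul hZ.le, Real.sqrt_sq_eq_abs, mul_comm]
    have e2 : ‖w - u‖ ≤ √Z * (√Z * ‖v‖) := by
      refine L2.norm_le_of_ae_bound hZ (by positivity) ?_
      filter_upwards [Lp.coeFn_sub w u, hw, h,
        ae_restrict_mem measurableSet_Ioo] with z h1 h2 h3 h4
      rw [h1, Pi.sub_apply, h2, h3, primitive, sub_add_cancel_left, abs_neg]
      exact abs_integral_le (Ioo_subset_Icc_self h4) v
    rw [← e1]
    calc ‖w‖ = ‖u + (w - u)‖ := by rw [add_sub_cancel]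
      _ ≤ ‖u‖ + ‖w - u‖ := norm_add_le _ _
      _ ≤ _ := by gcongr
  have hc' : |c| ≤ 1 / √Z * ‖u‖ + √Z * ‖v‖ := by
    have : |c| = (|c| * √Z) / √Z := by field_simp
    rw [this]
    calc _ ≤ (‖u‖ + √Z * (√Z * ‖v‖)) / √Z := by gcongr
      _ = _ := by field_simp
  calc |primitive c v x| ≤ |c| + |∫ t in (0 : ℝ)..x, v t| := abs_add_le _ _
    _ ≤ (1 / √Z * ‖u‖ + √Z * ‖v‖) + √Z * ‖v‖ := add_le_add hc' (abs_integral_le hx v)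
    -- Nonnegative terms are added so that `‖u‖` and `‖v‖` get the same factor.
    _ ≤ (1 / √Z * ‖u‖ + √Z * ‖v‖) + √Z * ‖v‖ + (1 / √Z * ‖v‖ + 2 * √Z * ‖u‖) := by
        have : 0 ≤ 1 / √Z * ‖v‖ + 2 * √Z * ‖u‖ := by positivity
        linarith
    _ = _ := by unfold sobolevConst; ring

/-- Continuous functions on `[0, Z]` that agree almost everywhere agree at every point, endpoints
included, so any representative may be replaced by the primitive. -/
theorem hasValueAt_iff_primitive {Z c x a : ℝ} (hZ : 0 < Z) {u v : L2 Z}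
    (h : u =ᵐ[vol Z] primitive c v) (hx : x ∈ Icc 0 Z) :
    HasValueAt u x a ↔ primitive c v x = a := by
  constructor
  · rintro ⟨f, hf, hfu, rfl⟩
    have hae : primitive c v =ᵐ[volume.restrict (Icc 0 Z)] f := by
      rw [← restrict_Ioo_eq_restrict_Icc]
      exact (hfu.trans h).symm
    exact Measure.eqOn_Icc_of_ae_eq volume hZ.ne hae (primitive_continuousOn hZ c v) hf hx
  · intro hp
    exact ⟨_, primitive_continuousOn hZ c v, h.symm, hp⟩

theorem IsWeakDeriv.exists_hasValueAt {Z x : ℝ} (hZ : 0 < Z) {u v : L2 Z}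
    (h : IsWeakDeriv Z u v) (hx : x ∈ Icc 0 Z) :
    ∃ a, HasValueAt u x a ∧ |a| ≤ sobolevConst Z * (‖u‖ + ‖v‖) := by
  obtain ⟨c, hc⟩ := h.exists_primitive hZ
  exact ⟨_, (hasValueAt_iff_primitive hZ hc hx).2 rfl, abs_primitive_le hZ hc hx⟩

theorem IsWeakDeriv.ae_abs_le {Z : ℝ} (hZ : 0 < Z) {u v : L2 Z} (h : IsWeakDeriv Z u v) :
    ∀ᵐ z ∂vol Z, |u z| ≤ sobolevConst Z * (‖u‖ + ‖v‖) := by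
  obtain ⟨c, hc⟩ := h.exists_primitive hZ
  filter_upwards [hc, ae_restrict_mem measurableSet_Ioo] with z hz hz'
  rw [hz]
  exact abs_primitive_le hZ hc (Ioo_subset_Icc_self hz')

theorem HasValueAt.unique {Z x a b : ℝ} (hZ : 0 < Z) {u : L2 Z} (hx : x ∈ Icc 0 Z)
    (ha : HasValueAt u x a) (hb : HasValueAt u x b) : a = b := by
  obtain ⟨f, hf, hfu, rfl⟩ := ha
  obtain ⟨g, hg, hgu, rfl⟩ := hb
  have hae : f =ᵐ[volume.restrict (Icc 0 Z)] g := by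
    rw [← restrict_Ioo_eq_restrict_Icc]
    exact hfu.trans hgu.symm
  exact Measure.eqOn_Icc_of_ae_eq volume hZ.ne hae hf hg hx

theorem IsWeakDeriv.ae_eq_integral {Z : ℝ} (hZ : 0 < Z) {u v : L2 Z} (h : IsWeakDeriv Z u v)
    (h0 : HasValueAt u 0 0) : ∀ᵐ z ∂vol Z, u z = ∫ t in (0 : ℝ)..z, v t := by
  obtain ⟨c, hc⟩ := h.exists_primitive hZ
  have hc0 := (hasValueAt_iff_primitive hZ hc (left_mem_Icc.2 hZ.le)).1 h0
  filter_upwards [hc] with z hz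
  simp only [primitive, intervalIntegral.integral_same, add_zero] at hc0
  rw [hz, primitive, hc0, zero_add]

/-- Poincaré's inequality. -/
theorem IsWeakDeriv.norm_le {Z : ℝ} (hZ : 0 < Z) {u v : L2 Z} (h : IsWeakDeriv Z u v)
    (h0 : HasValueAt u 0 0) : ‖u‖ ≤ Z * ‖v‖ := by
  have := L2.norm_le_of_ae_bound hZ (f := u) (C := √Z * ‖v‖) (by positivity) (by
    filter_upwards [h.ae_eq_integral hZ h0, ae_restrict_mem measurableSet_Ioo] with z hz hz'
    rw [hz]
    exact abs_integral_le (Ioo_subset_Icc_self hz') v)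
  rwa [← mul_assoc, Real.mul_self_sqrt hZ.le] at this

/-- The Carleman estimate: with the weight `e^{-λz}`, the derivative controls the function with a
small constant, in the supremum norm. -/
theorem IsWeakDeriv.ae_abs_W_le {Z lam : ℝ} (hZ : 0 < Z) (hl : 0 < lam) {u v : L2 Z}
    (h : IsWeakDeriv Z u v) (h0 : HasValueAt u 0 0) :
    ∀ᵐ z ∂vol Z, |W Z lam u z| ≤ √(1 / (2 * lam)) * ‖W Z lam v‖ := by
  filter_upwards [coeFn_W lam u, h.ae_eq_integral hZ h0,
    ae_restrict_mem measurableSet_Ioo] with z h1 h2 h3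
  rw [h1, h2, abs_mul, Real.abs_exp]
  exact exp_mul_abs_integral_le' hl (Ioo_subset_Icc_self h3) v

theorem IsWeakDeriv.norm_W_le {Z lam : ℝ} (hZ : 0 < Z) (hl : 0 < lam) {u v : L2 Z}
    (h : IsWeakDeriv Z u v) (h0 : HasValueAt u 0 0) :
    ‖W Z lam u‖ ≤ √Z * (√(1 / (2 * lam)) * ‖W Z lam v‖) :=
  L2.norm_le_of_ae_bound hZ (by positivity) (h.ae_abs_W_le hZ hl h0)

/-! ### Derivatives as bounded operators on `H²`, and completeness of `H²`. -/

theorem isWeakDeriv_d0 {Z : ℝ} (u : H2 Z) : IsWeakDeriv Z (d0 u) (d1 u) := u.2.1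

theorem isWeakDeriv_d1 {Z : ℝ} (u : H2 Z) : IsWeakDeriv Z (d1 u) (d2 u) := u.2.2

theorem H2.norm_sq_eq {Z : ℝ} (u : H2 Z) : ‖u‖ ^ 2 = ‖d0 u‖ ^ 2 + ‖d1 u‖ ^ 2 + ‖d2 u‖ ^ 2 := by
  have h : ‖u.1‖ ^ 2 = ∑ i, ‖u.1 i‖ ^ 2 := PiLp.norm_sq_eq_of_L2 _ _
  rw [Fin.sum_univ_three] at h
  exact h

theorem norm_d0_le {Z : ℝ} (u : H2 Z) : ‖d0 u‖ ≤ ‖u‖ :=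
  le_of_sq_le_sq (by rw [u.norm_sq_eq]; nlinarith [sq_nonneg ‖d1 u‖, sq_nonneg ‖d2 u‖])
    (norm_nonneg u)

theorem norm_d1_le {Z : ℝ} (u : H2 Z) : ‖d1 u‖ ≤ ‖u‖ :=
  le_of_sq_le_sq (by rw [u.norm_sq_eq]; nlinarith [sq_nonneg ‖d0 u‖, sq_nonneg ‖d2 u‖])
    (norm_nonneg u)

theorem norm_d2_le {Z : ℝ} (u : H2 Z) : ‖d2 u‖ ≤ ‖u‖ :=
  le_of_sq_le_sq (by rw [u.norm_sq_eq]; nlinarith [sq_nonneg ‖d0 u‖, sq_nonneg ‖d1 u‖])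
    (norm_nonneg u)

/-- The derivative `u'` as a bounded operator from `H²(0, Z)` to `L²(0, Z)`. -/
def d1L (Z : ℝ) : H2 Z →L[ℝ] L2 Z :=
  LinearMap.mkContinuous ⟨⟨d1, fun _ _ => rfl⟩, fun _ _ => rfl⟩ 1
    fun u => (norm_d1_le u).trans_eq (one_mul _).symm

/-- The second derivative `u''` as a bounded operator from `H²(0, Z)` to `L²(0, Z)`. -/
def d2L (Z : ℝ) : H2 Z →L[ℝ] L2 Z :=
  LinearMap.mkContinuous ⟨⟨d2, fun _ _ => rfl⟩, fun _ _ => rfl⟩ 1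
    fun u => (norm_d2_le u).trans_eq (one_mul _).symm

theorem ae_abs_d1_le {Z : ℝ} (hZ : 0 < Z) (u : H2 Z) :
    ∀ᵐ z ∂vol Z, ‖d1 u z‖ ≤ 2 * sobolevConst Z * ‖u‖ := by
  filter_upwards [(isWeakDeriv_d1 u).ae_abs_le hZ] with z hz
  refine hz.trans ?_
  nlinarith [norm_d1_le u, norm_d2_le u, sobolevConst_nonneg Z]

theorem memLp_top_d1 {Z : ℝ} (hZ : 0 < Z) (u : H2 Z) : MemLp (d1 u) ⊤ (vol Z) :=
  memLp_top_of_bound (Lp.aestronglyMeasurable _) _ (ae_abs_d1_le hZ u)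

/-- The derivative `u'` as a bounded operator from `H²(0, Z)` to `L^∞(0, Z)`. -/
def d1Inf {Z : ℝ} (hZ : 0 < Z) : H2 Z →L[ℝ] Lp ℝ ⊤ (vol Z) :=
  LinearMap.mkContinuous
    { toFun := fun u => (memLp_top_d1 hZ u).toLp
      map_add' := fun u v => by
        rw [← MemLp.toLp_add]
        exact MemLp.toLp_congr _ _ (Lp.coeFn_add (d1 u) (d1 v))
      map_smul' := fun c u => by
        rw [RingHom.id_apply, ← MemLp.toLp_const_smul]
        exact MemLp.toLp_congr _ _ (Lp.coeFn_smul c (d1 u)) }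
    (2 * sobolevConst Z) fun u => by
      have h := Lp.norm_le_of_ae_bound (f := (memLp_top_d1 hZ u).toLp)
        (C := 2 * sobolevConst Z * ‖u‖)
        (mul_nonneg (mul_nonneg zero_le_two (sobolevConst_nonneg Z)) (norm_nonneg u)) (by
          filter_upwards [ae_abs_d1_le hZ u, (memLp_top_d1 hZ u).coeFn_toLp] with z h1 h2
          rw [h2]
          exact h1)
      simpa using h

theorem coeFn_d1Inf {Z : ℝ} (hZ : 0 < Z) (u : H2 Z) : d1Inf hZ u =ᵐ[vol Z] d1 u :=
  (memLp_top_d1 hZ u).coeFn_toLp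

theorem norm_d1Inf_apply_le {Z : ℝ} (hZ : 0 < Z) (u : H2 Z) :
    ‖d1Inf hZ u‖ ≤ 2 * sobolevConst Z * ‖u‖ :=
  (d1Inf hZ).le_of_opNorm_le (LinearMap.mkContinuous_norm_le _
    (mul_nonneg zero_le_two (sobolevConst_nonneg Z)) _) u

theorem norm_sq_le_of_boundary {Z : ℝ} (hZ : 0 < Z) {u : H2 Z} (h0 : HasValueAt (d0 u) 0 0)
    (h1 : HasValueAt (d1 u) 0 0) : ‖u‖ ^ 2 ≤ (1 + Z ^ 2 + Z ^ 4) * ‖d2 u‖ ^ 2 := by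
  have e1 := (isWeakDeriv_d1 u).norm_le hZ h1
  have e0 := (isWeakDeriv_d0 u).norm_le hZ h0
  have e0' : ‖d0 u‖ ≤ Z ^ 2 * ‖d2 u‖ := e0.trans (by nlinarith)
  have f1 := pow_le_pow_left₀ (norm_nonneg _) e1 2
  have f0 := pow_le_pow_left₀ (norm_nonneg _) e0' 2
  rw [u.norm_sq_eq]
  nlinarith

theorem continuous_integral_mul_test {Z : ℝ} {ψ : ℝ → ℝ} (hψ : Continuous ψ)
    (hc : HasCompactSupport ψ) : Continuous fun u : L2 Z => ∫ z in Ioo 0 Z, u z * ψ z := by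
  have hm : MemLp ψ 2 (vol Z) := hψ.memLp_of_hasCompactSupport hc
  have h : (fun u : L2 Z => ∫ z in Ioo 0 Z, u z * ψ z) = fun u => inner ℝ (hm.toLp ψ) u := by
    ext u
    rw [L2.inner_def]
    apply integral_congr_ae
    filter_upwards [hm.coeFn_toLp] with z hz
    rw [hz]
    simp
  rw [h]
  fun_prop

/-- Pairing with a fixed test function is continuous on `L²`, so being a weak derivative is an
intersection of closed conditions. This gives completeness of `H²`. -/
theorem isClosed_H2Triples (Z : ℝ) :
    IsClosed (H2Triples Z : Set (PiLp 2 (fun _ : Fin 3 => L2 Z))) := by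
  have key : ∀ i j : Fin 3,
      IsClosed {U : PiLp 2 (fun _ : Fin 3 => L2 Z) | IsWeakDeriv Z (U i) (U j)} := by
    intro i j
    simp only [IsWeakDeriv, ofPred_forall]
    refine isClosed_iInter fun φ => isClosed_iInter fun hφ => isClosed_iInter fun hc =>
      isClosed_iInter fun _ => isClosed_eq ?_ ?_
    · exact (continuous_integral_mul_test (hφ.continuous_deriv (by simp)) hc.deriv).comp
        (PiLp.continuous_apply 2 _ i)
    · exact ((continuous_integral_mul_test hφ.continuous hc).comp
        (PiLp.continuous_apply 2 _ j)).neg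
  exact (key 0 1).inter (key 1 2)

instance (Z : ℝ) : CompleteSpace (H2 Z) :=
  (isClosed_H2Triples Z).completeSpace_coe

/-! ### Boundary conditions; closedness and convexity of `V` and `B`. -/

theorem HasValueAt.add {Z x a b : ℝ} {u v : L2 Z} (h : HasValueAt u x a)
    (h' : HasValueAt v x b) : HasValueAt (u + v) x (a + b) := by
  obtain ⟨f, hf, hfu, hx⟩ := h
  obtain ⟨g, hg, hgv, hx'⟩ := h'
  exact ⟨f + g, hf.add hg, (hfu.add hgv).trans (Lp.coeFn_add u v).symm, by simp [hx, hx']⟩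

theorem HasValueAt.smul {Z x a : ℝ} {u : L2 Z} (c : ℝ) (h : HasValueAt u x a) :
    HasValueAt (c • u) x (c * a) := by
  obtain ⟨f, hf, hfu, hx⟩ := h
  exact ⟨c • f, hf.const_smul c, (hfu.const_smul c).trans (Lp.coeFn_smul c u).symm,
    by simp [hx]⟩

theorem HasValueAt.sub {Z x a b : ℝ} {u v : L2 Z} (h : HasValueAt u x a)
    (h' : HasValueAt v x b) : HasValueAt (u - v) x (a - b) := by
  have := h.add (h'.smul (-1))
  simpa [sub_eq_add_neg] using this

theorem IsWeakDeriv.sub {Z : ℝ} {u v u' v' : L2 Z} (h : IsWeakDeriv Z u v)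
    (h' : IsWeakDeriv Z u' v') : IsWeakDeriv Z (u - u') (v - v') := by
  have := h.add (h'.smul (-1))
  simpa [sub_eq_add_neg] using this

/-- The condition `w(x) = a` is closed in `H¹(0, Z)`. -/
theorem isClosed_hasValueAt {X : Type*} [TopologicalSpace X] {Z x : ℝ} (hZ : 0 < Z)
    (hx : x ∈ Icc 0 Z) (a : ℝ) {f f' : X → L2 Z} (hf : Continuous f) (hf' : Continuous f')
    (h : ∀ y, IsWeakDeriv Z (f y) (f' y)) : IsClosed {y | HasValueAt (f y) x a} := by
  rw [← closure_subset_iff_isClosed]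
  intro y hy
  obtain ⟨b, hb, -⟩ := (h y).exists_hasValueAt hZ hx
  have hle : ∀ w ∈ {w | HasValueAt (f w) x a},
      |b - a| ≤ sobolevConst Z * (‖f y - f w‖ + ‖f' y - f' w‖) := by
    -- The embedding bounds the gap between `b` and `a` by the distance from `y` to any `w`
    -- satisfying the condition. This closed inequality passes to the limit `w = y`, where its right
    -- side vanishes.
    intro w hw
    obtain ⟨c, hc, hc'⟩ := ((h y).sub (h w)).exists_hasValueAt hZ hx
    rwa [← hc.unique hZ hx (hb.sub hw)]
  have hcl : IsClosed {w | |b - a| ≤ sobolevConst Z * (‖f y - f w‖ + ‖f' y - f' w‖)} :=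
    isClosed_le continuous_const (by fun_prop)
  have : |b - a| ≤ sobolevConst Z * (‖f y - f y‖ + ‖f' y - f' y‖) := closure_minimal hle hcl hy
  simp only [sub_self, norm_zero, add_zero, mul_zero] at this
  have hab : b = a := sub_eq_zero.1 (abs_nonpos_iff.1 this)
  exact hab ▸ hb

theorem isClosed_boundaryCond {X : Type*} [TopologicalSpace X] {Z : ℝ} (hZ : 0 < Z)
    (a b c : ℝ) {f : X → H2 Z} (hf : Continuous f) :
    IsClosed {y | BoundaryCond (f y) a b c} := by
  have c0 : Continuous fun y => d0 (f y) := by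
    have : Continuous (d0 (Z := Z)) :=
      (LinearMap.mkContinuous ⟨⟨d0, fun _ _ => rfl⟩, fun _ _ => rfl⟩ 1
        fun u => (norm_d0_le u).trans_eq (one_mul _).symm : H2 Z →L[ℝ] L2 Z).continuous
    exact this.comp hf
  have c1 : Continuous fun y => d1 (f y) := (d1L Z).continuous.comp hf
  have c2 : Continuous fun y => d2 (f y) := (d2L Z).continuous.comp hf
  exact (isClosed_hasValueAt hZ (left_mem_Icc.2 hZ.le) a c0 c1
      fun y => isWeakDeriv_d0 (f y)).inter
    ((isClosed_hasValueAt hZ (left_mem_Icc.2 hZ.le) b c1 c2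
      fun y => isWeakDeriv_d1 (f y)).inter
    (isClosed_hasValueAt hZ (right_mem_Icc.2 hZ.le) c c1 c2 fun y => isWeakDeriv_d1 (f y)))

theorem BoundaryCond.convex {Z a b c : ℝ} {u v : H2 Z} (hu : BoundaryCond u a b c)
    (hv : BoundaryCond v a b c) {s t : ℝ} (hst : s + t = 1) :
    BoundaryCond (s • u + t • v) a b c := by
  have key : ∀ {w w' : L2 Z} {x e : ℝ}, HasValueAt w x e → HasValueAt w' x e →
      HasValueAt (s • w + t • w') x e := by
    intro w w' x e h h'
    have := (h.smul s).add (h'.smul t)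
    rwa [← add_mul, hst, one_mul] at this
  exact ⟨key hu.1 hv.1, key hu.2.1 hv.2.1, key hu.2.2 hv.2.2⟩

theorem BoundaryCond.sub {Z a b c : ℝ} {u v : H2 Z} (hu : BoundaryCond u a b c)
    (hv : BoundaryCond v a b c) : BoundaryCond (u - v) 0 0 0 := by
  have key : ∀ {w w' : L2 Z} {x e : ℝ}, HasValueAt w x e → HasValueAt w' x e →
      HasValueAt (w - w') x 0 := by
    intro w w' x e h h'
    simpa using h.sub h'
  exact ⟨key hu.1 hv.1, key hu.2.1 hv.2.1, key hu.2.2 hv.2.2⟩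

theorem sub_mem_V {Z ε R k : ℝ} {g : ℝ → ℝ} {x y : H2Pair Z} (hx : x ∈ B Z ε R g k)
    (hy : y ∈ B Z ε R g k) : x - y ∈ V Z :=
  ⟨hx.2.1.sub hy.2.1, hx.2.2.sub hy.2.2⟩

theorem norm_fst_le {Z : ℝ} (x : H2Pair Z) : ‖x.fst‖ ≤ ‖x‖ := WithLp.norm_fst_le _ x

theorem norm_snd_le {Z : ℝ} (x : H2Pair Z) : ‖x.snd‖ ≤ ‖x‖ := WithLp.norm_snd_le _ x

theorem H2Pair.norm_sq_eq {Z : ℝ} (x : H2Pair Z) : ‖x‖ ^ 2 = ‖x.fst‖ ^ 2 + ‖x.snd‖ ^ 2 :=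
  WithLp.prod_norm_sq_eq_of_L2 x

/-- The projection `(q, r) ↦ q`. -/
def fstL (Z : ℝ) : H2Pair Z →L[ℝ] H2 Z := WithLp.fstL 2 ℝ (H2 Z) (H2 Z)

/-- The projection `(q, r) ↦ r`. -/
def sndL (Z : ℝ) : H2Pair Z →L[ℝ] H2 Z := WithLp.sndL 2 ℝ (H2 Z) (H2 Z)

@[simp] theorem fstL_apply {Z : ℝ} (x : H2Pair Z) : fstL Z x = x.fst := rfl

@[simp] theorem sndL_apply {Z : ℝ} (x : H2Pair Z) : sndL Z x = x.snd := rfl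

theorem isClosed_V {Z : ℝ} (hZ : 0 < Z) : IsClosed (V Z : Set (H2Pair Z)) :=
  (isClosed_boundaryCond hZ 0 0 0 (fstL Z).continuous).inter
    (isClosed_boundaryCond hZ 0 0 0 (sndL Z).continuous)

theorem isClosed_B {Z ε R k : ℝ} (hZ : 0 < Z) (g : ℝ → ℝ) : IsClosed (B Z ε R g k) :=
  (isClosed_le ((fstL Z).continuous.norm.add (sndL Z).continuous.norm) continuous_const).inter
    ((isClosed_boundaryCond hZ _ _ _ (fstL Z).continuous).inter
      (isClosed_boundaryCond hZ _ _ _ (sndL Z).continuous))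

theorem convex_B (Z ε R k : ℝ) (g : ℝ → ℝ) : Convex ℝ (B Z ε R g k) := by
  intro x hx y hy s t hs ht hst
  refine ⟨?_, hx.2.1.convex hy.2.1 hst, hx.2.2.convex hy.2.2 hst⟩
  have h1 : ‖s • x.fst + t • y.fst‖ ≤ s * ‖x.fst‖ + t * ‖y.fst‖ := by
    refine (norm_add_le _ _).trans_eq ?_
    rw [norm_smul, norm_smul, Real.norm_of_nonneg hs, Real.norm_of_nonneg ht]
  have h2 : ‖s • x.snd + t • y.snd‖ ≤ s * ‖x.snd‖ + t * ‖y.snd‖ := by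
    refine (norm_add_le _ _).trans_eq ?_
    rw [norm_smul, norm_smul, Real.norm_of_nonneg hs, Real.norm_of_nonneg ht]
  have h3 := mul_le_mul_of_nonneg_left hx.1 hs
  have h4 := mul_le_mul_of_nonneg_left hy.1 ht
  calc ‖s • x.fst + t • y.fst‖ + ‖s • x.snd + t • y.snd‖ ≤ s * R + t * R := by linarith
    _ = R := by rw [← add_mul, hst, one_mul]

theorem norm_le_of_mem_B {Z ε R k : ℝ} {g : ℝ → ℝ} {x : H2Pair Z} (hx : x ∈ B Z ε R g k) :
    ‖x‖ ≤ R := by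
  refine (le_of_sq_le_sq ?_ (by positivity)).trans hx.1
  rw [H2Pair.norm_sq_eq]
  nlinarith [norm_nonneg x.fst, norm_nonneg x.snd]

/-! ### Calculus of squared norms of quadratic maps. -/

section QuadraticMap

variable {E H : Type*} [NormedAddCommGroup E] [NormedSpace ℝ E] [NormedAddCommGroup H]
  [InnerProductSpace ℝ H]

/-- The map `x ↦ S x + N(x, x)` with linear `S` and bilinear `N`. -/
def quadMap (S : E →L[ℝ] H) (N : E →L[ℝ] E →L[ℝ] H) (x : E) : H := S x + N x x

/-- The derivative of `quadMap S N`. -/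
def quadMapDeriv (S : E →L[ℝ] H) (N : E →L[ℝ] E →L[ℝ] H) (x : E) : E →L[ℝ] H :=
  S + N x + N.flip x

theorem quadMapDeriv_apply (S : E →L[ℝ] H) (N : E →L[ℝ] E →L[ℝ] H) (x h : E) :
    quadMapDeriv S N x h = S h + N x h + N h x := rfl

/-- The derivative of `‖quadMap S N x‖²`. -/
def normSqQuadMapDeriv (S : E →L[ℝ] H) (N : E →L[ℝ] E →L[ℝ] H) (x : E) : E →L[ℝ] ℝ :=
  (2 : ℝ) • (innerSL ℝ (quadMap S N x)).comp (quadMapDeriv S N x)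

theorem normSqQuadMapDeriv_apply (S : E →L[ℝ] H) (N : E →L[ℝ] E →L[ℝ] H) (x h : E) :
    normSqQuadMapDeriv S N x h = 2 * inner ℝ (quadMap S N x) (quadMapDeriv S N x h) := rfl

theorem hasFDerivAt_quadMap (S : E →L[ℝ] H) (N : E →L[ℝ] E →L[ℝ] H) (x : E) :
    HasFDerivAt (quadMap S N) (quadMapDeriv S N x) x := by
  have h := S.hasFDerivAt (x := x) |>.add
    (N.hasFDerivAt_of_bilinear (hasFDerivAt_id x) (hasFDerivAt_id x))
  refine h.congr_fderiv ?_
  ext y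
  simp [quadMapDeriv]
  abel

theorem hasFDerivAt_normSq_quadMap (S : E →L[ℝ] H) (N : E →L[ℝ] E →L[ℝ] H) (x : E) :
    HasFDerivAt (fun y => ‖quadMap S N y‖ ^ 2) (normSqQuadMapDeriv S N x) x := by
  refine (hasFDerivAt_quadMap S N x).norm_sq.congr_fderiv ?_
  ext y
  simp [normSqQuadMapDeriv, two_mul]

/-- The map is quadratic, so its second order expansion is exact. The only remainder term without a
sign is the inner product, and it is quadratic in `h`. -/
theorem normSq_quadMap_add (S : E →L[ℝ] H) (N : E →L[ℝ] E →L[ℝ] H) (x h : E) :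
    ‖quadMap S N (x + h)‖ ^ 2 - ‖quadMap S N x‖ ^ 2 - normSqQuadMapDeriv S N x h
      = ‖quadMapDeriv S N x h + N h h‖ ^ 2 + 2 * inner ℝ (quadMap S N x) (N h h) := by
  have h1 : quadMap S N (x + h) = quadMap S N x + (quadMapDeriv S N x h + N h h) := by
    simp only [quadMap, quadMapDeriv_apply, map_add, add_apply]
    abel
  rw [h1, norm_add_sq_real, normSqQuadMapDeriv_apply, inner_add_right]
  ring

/-- The derivative pairs the map with its own derivative; on the ball of radius `R` both are bounded
and Lipschitz, and the difference splits as for a product. A one-sided bound suffices since `h` is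
arbitrary. -/
theorem normSqQuadMapDeriv_sub_le {S : E →L[ℝ] H} {N : E →L[ℝ] E →L[ℝ] H} {s n R : ℝ}
    (hS : ∀ x, ‖S x‖ ≤ s * ‖x‖) (hN : ∀ x y, ‖N x y‖ ≤ n * ‖x‖ * ‖y‖) (hs : 0 ≤ s)
    (hn : 0 ≤ n) (hR : 0 ≤ R) {x y : E} (hx : ‖x‖ ≤ R) (hy : ‖y‖ ≤ R) (h : E) :
    normSqQuadMapDeriv S N y h - normSqQuadMapDeriv S N x h
      ≤ 2 * ((s + 2 * n * R) ^ 2 + (s * R + n * R * R) * (2 * n)) * ‖y - x‖ * ‖h‖ := by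
  have e1 : ‖quadMap S N y - quadMap S N x‖ ≤ (s + 2 * n * R) * ‖y - x‖ := by
    have : quadMap S N y - quadMap S N x = S (y - x) + N (y - x) y + N x (y - x) := by
      simp only [quadMap, map_sub, sub_apply]
      abel
    rw [this]
    calc _ ≤ ‖S (y - x)‖ + ‖N (y - x) y‖ + ‖N x (y - x)‖ := norm_add₃_le
      _ ≤ s * ‖y - x‖ + n * ‖y - x‖ * R + n * R * ‖y - x‖ := by
        gcongr
        · exact hS _
        · exact (hN _ _).trans (by gcongr)
        · exact (hN _ _).trans (by gcongr)
      _ = _ := by ring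
  have e2 : ‖quadMapDeriv S N y h‖ ≤ (s + 2 * n * R) * ‖h‖ := by
    rw [quadMapDeriv_apply]
    calc _ ≤ ‖S h‖ + ‖N y h‖ + ‖N h y‖ := norm_add₃_le
      _ ≤ s * ‖h‖ + n * R * ‖h‖ + n * ‖h‖ * R := by
        gcongr
        · exact hS _
        · exact (hN _ _).trans (by gcongr)
        · exact (hN _ _).trans (by gcongr)
      _ = _ := by ring
  have e3 : ‖quadMap S N x‖ ≤ s * R + n * R * R := by
    refine (norm_add_le _ _).trans (add_le_add ((hS _).trans ?_) ((hN _ _).trans ?_)) <;> gcongr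
  have e4 : ‖quadMapDeriv S N y h - quadMapDeriv S N x h‖ ≤ 2 * n * ‖y - x‖ * ‖h‖ := by
    have : quadMapDeriv S N y h - quadMapDeriv S N x h = N (y - x) h + N h (y - x) := by
      simp only [quadMapDeriv_apply, map_sub, sub_apply]
      abel
    rw [this]
    refine (norm_add_le _ _).trans ((add_le_add (hN _ _) (hN _ _)).trans_eq (by ring))
  have e5 : normSqQuadMapDeriv S N y h - normSqQuadMapDeriv S N x h
      = 2 * (inner ℝ (quadMap S N y - quadMap S N x) (quadMapDeriv S N y h)
        + inner ℝ (quadMap S N x) (quadMapDeriv S N y h - quadMapDeriv S N x h)) := by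
    rw [normSqQuadMapDeriv_apply, normSqQuadMapDeriv_apply, inner_sub_left, inner_sub_right]
    ring
  have e6 := real_inner_le_norm (quadMap S N y - quadMap S N x) (quadMapDeriv S N y h)
  have e7 := real_inner_le_norm (quadMap S N x) (quadMapDeriv S N y h - quadMapDeriv S N x h)
  have e8 := mul_le_mul e1 e2 (norm_nonneg _) (by positivity)
  have e9 := mul_le_mul e3 e4 (norm_nonneg _) (by positivity)
  rw [e5]
  calc _ ≤ 2 * ((s + 2 * n * R) * ‖y - x‖ * ((s + 2 * n * R) * ‖h‖)
        + (s * R + n * R * R) * (2 * n * ‖y - x‖ * ‖h‖)) := by linarith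
    _ = _ := by ring

end QuadraticMap

theorem half_sq_sub_sq_le_norm_add_sq {H : Type*} [NormedAddCommGroup H] (a b : H) :
    ‖a‖ ^ 2 / 2 - ‖b‖ ^ 2 ≤ ‖a + b‖ ^ 2 := by
  have h1 : ‖a‖ ≤ ‖a + b‖ + ‖b‖ := by
    calc ‖a‖ = ‖(a + b) - b‖ := by rw [add_sub_cancel_right]
      _ ≤ _ := norm_sub_le _ _
  nlinarith [norm_nonneg a, norm_nonneg b, norm_nonneg (a + b), sq_nonneg (‖a + b‖ - ‖b‖)]

/-! ### The weighted operators as quadratic maps, and the gradient of `J`. -/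

variable {Z : ℝ}

/-- The bounded bilinear map `(u, v) ↦ u' v'` from `H²(0, Z)²` to `L²(0, Z)`. -/
def derivMul (hZ : 0 < Z) : H2 Z →L[ℝ] H2 Z →L[ℝ] L2 Z :=
  (mulInf Z).bilinearComp (d1Inf hZ) (d1L Z)

theorem coeFn_derivMul (hZ : 0 < Z) (u v : H2 Z) :
    derivMul hZ u v =ᵐ[vol Z] fun z => d1 u z * d1 v z := by
  filter_upwards [coeFn_mulInf (d1Inf hZ u) (d1 v), coeFn_d1Inf hZ u] with z h1 h2
  rw [← h2, ← h1]
  rfl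

theorem derivMul_comm (hZ : 0 < Z) (u v : H2 Z) : derivMul hZ u v = derivMul hZ v u := by
  apply Lp.ext
  filter_upwards [coeFn_derivMul hZ u v, coeFn_derivMul hZ v u] with z h1 h2
  rw [h1, h2, mul_comm]

/-- The weight goes to the square integrable factor, where the Carleman estimate applies; the other
factor stays in `L^∞`. -/
theorem W_derivMul (hZ : 0 < Z) (lam : ℝ) (u v : H2 Z) :
    W Z lam (derivMul hZ u v) = mulInf Z (d1Inf hZ u) (W Z lam (d1 v)) := by
  apply Lp.ext
  filter_upwards [coeFn_W lam (derivMul hZ u v), coeFn_derivMul hZ u v, coeFn_W lam (d1 v),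
    coeFn_mulInf (d1Inf hZ u) (W Z lam (d1 v)), coeFn_d1Inf hZ u] with z h1 h2 h3 h4 h5
  rw [h1, h2, h4, h3, h5]
  ring

theorem norm_derivMul_le (hZ : 0 < Z) (u v : H2 Z) :
    ‖derivMul hZ u v‖ ≤ 2 * sobolevConst Z * ‖u‖ * ‖v‖ := by
  have h := norm_mulInf_apply_le (d1Inf hZ u) (d1 v)
  exact h.trans (mul_le_mul (norm_d1Inf_apply_le hZ u) (norm_d1_le v) (norm_nonneg _)
    ((norm_nonneg _).trans (norm_d1Inf_apply_le hZ u)))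

theorem norm_W_derivMul_le (hZ : 0 < Z) {lam : ℝ} (hl : 0 < lam) (u : H2 Z) {p : H2 Z}
    (hp : HasValueAt (d1 p) 0 0) :
    ‖W Z lam (derivMul hZ u p)‖ ≤
      2 * sobolevConst Z * ‖u‖ * (√Z * (√(1 / (2 * lam)) * ‖W Z lam (d2 p)‖)) := by
  rw [W_derivMul]
  exact (norm_mulInf_apply_le _ _).trans (mul_le_mul (norm_d1Inf_apply_le hZ u)
    ((isWeakDeriv_d1 p).norm_W_le hZ hl hp) (norm_nonneg _)
    ((norm_nonneg _).trans (norm_d1Inf_apply_le hZ u)))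

/-- Each factor takes one of the two weights, and the pointwise Carleman bound applies to both, each
contributing `(2λ)^{-1/2}`. -/
theorem norm_W_W_derivMul_le (hZ : 0 < Z) {lam : ℝ} (hl : 0 < lam) {u v : H2 Z}
    (hu : HasValueAt (d1 u) 0 0) (hv : HasValueAt (d1 v) 0 0) :
    ‖W Z lam (W Z lam (derivMul hZ u v))‖ ≤
      √Z * (1 / (2 * lam) * (‖W Z lam (d2 u)‖ * ‖W Z lam (d2 v)‖)) := by
  refine L2.norm_le_of_ae_bound hZ (by positivity) ?_
  filter_upwards [coeFn_W lam (W Z lam (derivMul hZ u v)), coeFn_W lam (derivMul hZ u v),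
    coeFn_derivMul hZ u v, coeFn_W lam (d1 u), coeFn_W lam (d1 v),
    (isWeakDeriv_d1 u).ae_abs_W_le hZ hl hu, (isWeakDeriv_d1 v).ae_abs_W_le hZ hl hv]
    with z h1 h2 h3 h4 h5 h6 h7
  have h8 : W Z lam (W Z lam (derivMul hZ u v)) z = W Z lam (d1 u) z * W Z lam (d1 v) z := by
    rw [h1, h2, h3, h4, h5]
    ring
  rw [h8, abs_mul]
  refine (mul_le_mul h6 h7 (abs_nonneg _) (by positivity)).trans_eq ?_
  have : √(1 / (2 * lam)) * √(1 / (2 * lam)) = 1 / (2 * lam) :=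
    Real.mul_self_sqrt (by positivity)
  linear_combination (‖W Z lam (d2 u)‖ * ‖W Z lam (d2 v)‖) * this

/-- The difference `(q, r) ↦ q - r`. -/
def diffL (Z : ℝ) : H2Pair Z →L[ℝ] H2 Z := fstL Z - sndL Z

theorem diffL_apply (x : H2Pair Z) : diffL Z x = x.fst - x.snd := rfl

theorem norm_diffL_le (x : H2Pair Z) : ‖diffL Z x‖ ≤ 2 * ‖x‖ := by
  have h := norm_sub_le x.fst x.snd
  rw [diffL_apply]
  linarith [norm_fst_le x, norm_snd_le x]

/-- The bilinear map whose diagonal is `a q' (q' - r') + b (q' - r')²`. -/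
def quadPart (hZ : 0 < Z) (a b : ℝ) : H2Pair Z →L[ℝ] H2Pair Z →L[ℝ] L2 Z :=
  a • (derivMul hZ).bilinearComp (fstL Z) (diffL Z)
    + b • (derivMul hZ).bilinearComp (diffL Z) (diffL Z)

theorem quadPart_apply (hZ : 0 < Z) (a b : ℝ) (x y : H2Pair Z) :
    quadPart hZ a b x y = a • derivMul hZ x.fst (diffL Z y)
      + b • derivMul hZ (diffL Z x) (diffL Z y) := rfl

/-- The linear map `(q, r) ↦ -c q' - d (q' - r')`. -/
def linPart (Z c d : ℝ) : H2Pair Z →L[ℝ] L2 Z :=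
  -(c • (d1L Z).comp (fstL Z)) - d • (d1L Z).comp (diffL Z)

theorem linPart_apply (c d : ℝ) (x : H2Pair Z) :
    linPart Z c d x = -(c • d1 x.fst) - d • d1 (diffL Z x) := rfl

/-- The weighted linear part of the operators `L₁` and `L₂`. -/
def weightedLin (Z lam c d : ℝ) (P : H2Pair Z →L[ℝ] H2 Z) : H2Pair Z →L[ℝ] L2 Z :=
  (W Z lam).comp ((d2L Z).comp P + linPart Z c d)

theorem weightedLin_apply (lam c d : ℝ) (P : H2Pair Z →L[ℝ] H2 Z) (x : H2Pair Z) :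
    weightedLin Z lam c d P x = W Z lam (d2 (P x) + linPart Z c d x) := rfl

/-- The weighted quadratic part of the operators `L₁` and `L₂`. -/
def weightedQuad (hZ : 0 < Z) (lam a b : ℝ) : H2Pair Z →L[ℝ] H2Pair Z →L[ℝ] L2 Z :=
  ((W Z lam).postcomp (H2Pair Z)).comp (quadPart hZ a b)

theorem weightedQuad_apply (hZ : 0 < Z) (lam a b : ℝ) (x y : H2Pair Z) :
    weightedQuad hZ lam a b x y = W Z lam (quadPart hZ a b x y) := rfl

theorem quadMap_weighted (hZ : 0 < Z) (lam a b c d : ℝ) (P : H2Pair Z →L[ℝ] H2 Z)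
    (x : H2Pair Z) : quadMap (weightedLin Z lam c d P) (weightedQuad hZ lam a b) x
      = W Z lam (d2 (P x) + linPart Z c d x + quadPart hZ a b x x) := by
  rw [quadMap, weightedLin_apply, weightedQuad_apply, ← map_add]

theorem lowerOrder_ae_eq (hZ : 0 < Z) (ε k : ℝ) (x : H2Pair Z) :
    (linPart Z (2 * √k) (1 / (ε * √k)) x + quadPart hZ (2 * (k / ε)) (1 / ε ^ 2) x x : L2 Z)
      =ᵐ[vol Z] lowerOrder ε k x := by
  have hdiff : d1 (diffL Z x) =ᵐ[vol Z] fun z => d1 x.fst z - d1 x.snd z :=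
    Lp.coeFn_sub (d1 x.fst) (d1 x.snd)
  rw [linPart_apply, quadPart_apply]
  filter_upwards [hdiff, coeFn_derivMul hZ x.fst (diffL Z x),
    coeFn_derivMul hZ (diffL Z x) (diffL Z x),
    Lp.coeFn_add (-((2 * √k) • d1 x.fst) - (1 / (ε * √k)) • d1 (diffL Z x))
      ((2 * (k / ε)) • derivMul hZ x.fst (diffL Z x)
        + (1 / ε ^ 2) • derivMul hZ (diffL Z x) (diffL Z x)),
    Lp.coeFn_sub (-((2 * √k) • d1 x.fst)) ((1 / (ε * √k)) • d1 (diffL Z x)),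
    Lp.coeFn_neg ((2 * √k) • d1 x.fst), Lp.coeFn_smul (2 * √k) (d1 x.fst),
    Lp.coeFn_smul (1 / (ε * √k)) (d1 (diffL Z x)),
    Lp.coeFn_add ((2 * (k / ε)) • derivMul hZ x.fst (diffL Z x))
      ((1 / ε ^ 2) • derivMul hZ (diffL Z x) (diffL Z x)),
    Lp.coeFn_smul (2 * (k / ε)) (derivMul hZ x.fst (diffL Z x)),
    Lp.coeFn_smul (1 / ε ^ 2) (derivMul hZ (diffL Z x) (diffL Z x))]
    with z h1 h2 h3 h4 h5 h6 h7 h8 h9 h10 h11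
  simp only [h4, h5, h6, h7, h8, h9, h10, h11, h2, h3, h1, Pi.add_apply, Pi.sub_apply,
    Pi.neg_apply, Pi.smul_apply, smul_eq_mul, lowerOrder]
  ring

theorem norm_W_sq {lam : ℝ} {f : L2 Z} {φ : ℝ → ℝ} (h : f =ᵐ[vol Z] φ) :
    ‖W Z lam f‖ ^ 2 = ∫ z in Ioo 0 Z, φ z ^ 2 * Real.exp (-2 * lam * z) := by
  rw [L2.norm_sq_eq]
  apply integral_congr_ae
  filter_upwards [coeFn_W lam f, h] with z h1 h2
  rw [h1, h2, mul_pow, mul_comm, ← Real.exp_nat_mul]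
  congr 2
  push_cast
  ring

theorem integrable_sq_mul_exp {lam : ℝ} {f : L2 Z} {φ : ℝ → ℝ} (h : f =ᵐ[vol Z] φ) :
    Integrable (fun z => φ z ^ 2 * Real.exp (-2 * lam * z)) (vol Z) := by
  refine (Lp.memLp (W Z lam f)).integrable_sq.congr ?_
  filter_upwards [coeFn_W lam f, h] with z h1 h2
  rw [h1, h2, mul_pow, mul_comm, ← Real.exp_nat_mul]
  congr 2
  push_cast
  ring

/-- The part `∫ L² e^{-2λz}` of the functional, with `L` built from the projection `P`. -/
def partialJ (hZ : 0 < Z) (ε lam k : ℝ) (P : H2Pair Z →L[ℝ] H2 Z) (x : H2Pair Z) : ℝ :=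
  ‖quadMap (weightedLin Z lam (2 * √k) (1 / (ε * √k)) P)
    (weightedQuad hZ lam (2 * (k / ε)) (1 / ε ^ 2)) x‖ ^ 2

theorem J_eq (hZ : 0 < Z) (ε lam k : ℝ) :
    J ε lam k = fun x => partialJ hZ ε lam k (fstL Z) x + partialJ hZ ε lam k (sndL Z) x := by
  funext x
  have hlow := lowerOrder_ae_eq hZ ε k x
  have key : ∀ w : L2 Z, (w + linPart Z (2 * √k) (1 / (ε * √k)) x
      + quadPart hZ (2 * (k / ε)) (1 / ε ^ 2) x x : L2 Z)
        =ᵐ[vol Z] fun z => w z + lowerOrder ε k x z := by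
    intro w
    rw [add_assoc]
    filter_upwards [Lp.coeFn_add w (linPart Z (2 * √k) (1 / (ε * √k)) x
      + quadPart hZ (2 * (k / ε)) (1 / ε ^ 2) x x), hlow] with z h1 h2
    rw [h1, Pi.add_apply, h2]
  have e1 := key (d2 x.fst)
  have e2 := key (d2 x.snd)
  rw [partialJ, partialJ, quadMap_weighted, quadMap_weighted, fstL_apply, sndL_apply,
    norm_W_sq e1, norm_W_sq e2, ← integral_add (integrable_sq_mul_exp e1)
      (integrable_sq_mul_exp e2)]
  simp only [J, L₁, L₂, add_mul]

/-- The derivative of the functional `J` on the whole space. -/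
def derivJ (hZ : 0 < Z) (ε lam k : ℝ) (x : H2Pair Z) : H2Pair Z →L[ℝ] ℝ :=
  normSqQuadMapDeriv (weightedLin Z lam (2 * √k) (1 / (ε * √k)) (fstL Z))
      (weightedQuad hZ lam (2 * (k / ε)) (1 / ε ^ 2)) x
    + normSqQuadMapDeriv (weightedLin Z lam (2 * √k) (1 / (ε * √k)) (sndL Z))
      (weightedQuad hZ lam (2 * (k / ε)) (1 / ε ^ 2)) x

theorem hasFDerivAt_J (hZ : 0 < Z) (ε lam k : ℝ) (x : H2Pair Z) :
    HasFDerivAt (J ε lam k) (derivJ hZ ε lam k x) x := by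
  rw [J_eq hZ]
  exact (hasFDerivAt_normSq_quadMap _ _ x).add (hasFDerivAt_normSq_quadMap _ _ x)

theorem hasFDerivAt_J_add (hZ : 0 < Z) (ε lam k : ℝ) (x : H2Pair Z) :
    HasFDerivAt (fun h : V Z => J ε lam k (x + (h : H2Pair Z)))
      ((derivJ hZ ε lam k x).comp (V Z).subtypeL) 0 := by
  have h1 : HasFDerivAt (fun h : V Z => x + (h : H2Pair Z)) (V Z).subtypeL 0 :=
    (V Z).subtypeL.hasFDerivAt.const_add x
  have h2 : HasFDerivAt (J ε lam k) (derivJ hZ ε lam k x) (x + ((0 : V Z) : H2Pair Z)) := by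
    simpa using hasFDerivAt_J hZ ε lam k x
  exact h2.comp (0 : V Z) h1

theorem IsFrechetDeriv.inner_eq (hZ : 0 < Z) {ε lam k : ℝ} {x : H2Pair Z} {G : V Z}
    (h : IsFrechetDeriv ε lam k x G) {y : H2Pair Z} (hy : y ∈ V Z) :
    inner ℝ (G : H2Pair Z) y = derivJ hZ ε lam k x y :=
  DFunLike.congr_fun (HasFDerivAt.unique h (hasFDerivAt_J_add hZ ε lam k x)) (⟨y, hy⟩ : V Z)

/-- Riesz representation of the restricted derivative; `V` is closed, hence complete. -/
theorem existsUnique_isFrechetDeriv (hZ : 0 < Z) (ε lam k : ℝ) (x : H2Pair Z) :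
    ∃! G : V Z, IsFrechetDeriv ε lam k x G := by
  have : CompleteSpace (V Z) := (isClosed_V hZ).completeSpace_coe
  refine ⟨(InnerProductSpace.toDual ℝ (V Z)).symm
    ((derivJ hZ ε lam k x).comp (V Z).subtypeL), ?_, ?_⟩
  · refine (hasFDerivAt_J_add hZ ε lam k x).congr_fderiv ?_
    ext y
    simp [InnerProductSpace.toDual_symm_apply]
  · intro G hG
    refine ext_inner_right ℝ (E := V Z) fun y => ?_
    rw [InnerProductSpace.toDual_symm_apply]
    exact hG.inner_eq hZ y.2

/-! ### Bounds uniform in `k`, and the Lipschitz estimate. -/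

theorem norm_linPart_le {A c d : ℝ} (hc : c ∈ Icc 0 A) (hd : d ∈ Icc 0 A) (x : H2Pair Z) :
    ‖linPart Z c d x‖ ≤ 3 * A * ‖x‖ := by
  rw [linPart_apply]
  have h1 := (norm_d1_le x.fst).trans (norm_fst_le x)
  have h2 := (norm_d1_le (diffL Z x)).trans (norm_diffL_le x)
  have hA := hc.1.trans hc.2
  calc _ ≤ ‖c • d1 x.fst‖ + ‖d • d1 (diffL Z x)‖ := (norm_sub_le _ _).trans_eq (by rw [norm_neg])
    _ = c * ‖d1 x.fst‖ + d * ‖d1 (diffL Z x)‖ := by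
      rw [norm_smul, norm_smul, Real.norm_of_nonneg hc.1, Real.norm_of_nonneg hd.1]
    _ ≤ A * ‖x‖ + A * (2 * ‖x‖) := by
      gcongr
      exacts [hc.2, hd.2]
    _ = _ := by ring

theorem norm_quadPart_le (hZ : 0 < Z) {A a b : ℝ} (ha : a ∈ Icc 0 A) (hb : b ∈ Icc 0 A)
    (x y : H2Pair Z) : ‖quadPart hZ a b x y‖ ≤ 12 * sobolevConst Z * A * ‖x‖ * ‖y‖ := by
  rw [quadPart_apply]
  have hs := sobolevConst_nonneg Z
  have hA := ha.1.trans ha.2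
  have h1 : ‖derivMul hZ x.fst (diffL Z y)‖ ≤ 2 * sobolevConst Z * ‖x‖ * (2 * ‖y‖) := by
    refine (norm_derivMul_le hZ _ _).trans ?_
    gcongr
    exacts [norm_fst_le x, norm_diffL_le y]
  have h2 : ‖derivMul hZ (diffL Z x) (diffL Z y)‖
      ≤ 2 * sobolevConst Z * (2 * ‖x‖) * (2 * ‖y‖) := by
    refine (norm_derivMul_le hZ _ _).trans ?_
    gcongr
    exacts [norm_diffL_le x, norm_diffL_le y]
  calc _ ≤ a * ‖derivMul hZ x.fst (diffL Z y)‖ + b * ‖derivMul hZ (diffL Z x) (diffL Z y)‖ := by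
        refine (norm_add_le _ _).trans_eq ?_
        rw [norm_smul, norm_smul, Real.norm_of_nonneg ha.1, Real.norm_of_nonneg hb.1]
    _ ≤ A * (2 * sobolevConst Z * ‖x‖ * (2 * ‖y‖))
        + A * (2 * sobolevConst Z * (2 * ‖x‖) * (2 * ‖y‖)) := by
      gcongr
      exacts [ha.2, hb.2]
    _ = _ := by ring

/-- A common bound for the coefficients of `L₁` and `L₂`. -/
def coeffBound (ε kmin kmax : ℝ) : ℝ :=
  2 * (kmax / ε) + 1 / ε ^ 2 + 2 * √kmax + 1 / (ε * √kmin)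

theorem coeff_mem_Icc {ε kmin kmax k : ℝ} (hε : 0 < ε) (hkmin : 0 < kmin)
    (hk : k ∈ Icc kmin kmax) :
    2 * (k / ε) ∈ Icc 0 (coeffBound ε kmin kmax) ∧ 1 / ε ^ 2 ∈ Icc 0 (coeffBound ε kmin kmax) ∧
      2 * √k ∈ Icc 0 (coeffBound ε kmin kmax) ∧
      1 / (ε * √k) ∈ Icc 0 (coeffBound ε kmin kmax) := by
  have hk0 : 0 < k := hkmin.trans_le hk.1
  have hkm : 0 < kmax := hk0.trans_le hk.2
  have hsq := Real.sqrt_pos.2 hkmin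
  have p1 : 0 ≤ 2 * (kmax / ε) := by positivity
  have p2 : 0 ≤ 1 / ε ^ 2 := by positivity
  have p3 : 0 ≤ 2 * √kmax := by positivity
  have p4 : 0 ≤ 1 / (ε * √kmin) := by positivity
  have q1 : 2 * (k / ε) ≤ 2 * (kmax / ε) := by
    have := hk.2
    gcongr
  have q3 : 2 * √k ≤ 2 * √kmax := by
    have := Real.sqrt_le_sqrt hk.2
    gcongr
  have q4 : 1 / (ε * √k) ≤ 1 / (ε * √kmin) := by
    have := Real.sqrt_le_sqrt hk.1
    gcongr
  unfold coeffBound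
  refine ⟨⟨by positivity, ?_⟩, ⟨by positivity, ?_⟩, ⟨by positivity, ?_⟩, ⟨by positivity, ?_⟩⟩ <;>
    linarith

theorem exists_lipschitz (hZ : 0 < Z) {R ε kmin kmax : ℝ} (hR : 0 < R) (hε : 0 < ε)
    (hkmin : 0 < kmin) (hk : kmin ≤ kmax) {lam : ℝ} (hl : 0 < lam) :
    ∃ D : ℝ, 0 < D ∧ ∀ k ∈ Icc kmin kmax, ∀ x y : H2Pair Z, ‖x‖ ≤ R → ‖y‖ ≤ R →
      ∀ h, derivJ hZ ε lam k y h - derivJ hZ ε lam k x h ≤ D * ‖y - x‖ * ‖h‖ := by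
  set A := coeffBound ε kmin kmax
  have hA : 0 ≤ A := by
    have := (coeff_mem_Icc (k := kmin) hε hkmin ⟨le_rfl, hk⟩).1
    exact this.1.trans this.2
  have hc := sobolevConst_nonneg Z
  set s := 1 + 3 * A
  set n := 12 * sobolevConst Z * A
  have hs : 0 < s := by positivity
  have hn : 0 ≤ n := by positivity
  -- The outer factor `2` counts the two components of `J`; `s` and `n` bound the linear and
  -- bilinear parts, as `W` has norm at most `1`.
  refine ⟨2 * (2 * ((s + 2 * n * R) ^ 2 + (s * R + n * R * R) * (2 * n))), by positivity, ?_⟩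
  intro k hk x y hx hy h
  obtain ⟨c1, c2, c3, c4⟩ := coeff_mem_Icc hε hkmin hk
  have hS : ∀ P : H2Pair Z →L[ℝ] H2 Z, (∀ x, ‖P x‖ ≤ ‖x‖) → ∀ x,
      ‖weightedLin Z lam (2 * √k) (1 / (ε * √k)) P x‖ ≤ s * ‖x‖ := by
    intro P hP x
    rw [weightedLin_apply]
    refine (norm_W_le hl.le _).trans ((norm_add_le _ _).trans ?_)
    calc _ ≤ ‖x‖ + 3 * A * ‖x‖ :=
        add_le_add ((norm_d2_le _).trans (hP x)) (norm_linPart_le c3 c4 x)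
      _ = _ := by ring
  have hN : ∀ x y : H2Pair Z,
      ‖weightedQuad hZ lam (2 * (k / ε)) (1 / ε ^ 2) x y‖ ≤ n * ‖x‖ * ‖y‖ := fun x y =>
    (norm_W_le hl.le _).trans (norm_quadPart_le hZ c1 c2 x y)
  have e1 := normSqQuadMapDeriv_sub_le (hS (fstL Z) norm_fst_le) hN hs.le hn hR.le hx hy h
  have e2 := normSqQuadMapDeriv_sub_le (hS (sndL Z) norm_snd_le) hN hs.le hn hR.le hx hy h
  simp only [derivJ, add_apply]
  linarith

/-! ### Absorption of the lower order terms and strong convexity. -/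

/-- The sum of the weighted norms of the second derivatives. -/
def weightedNorm (lam : ℝ) (h : H2Pair Z) : ℝ :=
  ‖W Z lam (d2 h.fst)‖ + ‖W Z lam (d2 h.snd)‖

theorem weightedNorm_nonneg (lam : ℝ) (h : H2Pair Z) : 0 ≤ weightedNorm lam h :=
  add_nonneg (norm_nonneg _) (norm_nonneg _)

theorem norm_W_d2_fst_le (lam : ℝ) (h : H2Pair Z) :
    ‖W Z lam (d2 h.fst)‖ ≤ weightedNorm lam h :=
  le_add_of_nonneg_right (norm_nonneg _)

theorem norm_W_d2_diffL_le (lam : ℝ) (h : H2Pair Z) :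
    ‖W Z lam (d2 (diffL Z h))‖ ≤ weightedNorm lam h := by
  have : d2 (diffL Z h) = d2 h.fst - d2 h.snd := rfl
  rw [this, map_sub]
  exact norm_sub_le _ _

theorem hasValueAt_d1_fst {h : H2Pair Z} (hh : h ∈ V Z) : HasValueAt (d1 h.fst) 0 0 := hh.1.2.1

theorem hasValueAt_d1_diffL {h : H2Pair Z} (hh : h ∈ V Z) :
    HasValueAt (d1 (diffL Z h)) 0 0 := by
  have := hh.1.2.1.sub hh.2.2.1
  rwa [sub_zero] at this

theorem norm_W_linPart_le (hZ : 0 < Z) {lam A c d : ℝ} (hl : 0 < lam) (hc : c ∈ Icc 0 A)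
    (hd : d ∈ Icc 0 A) {h : H2Pair Z} (hh : h ∈ V Z) :
    ‖W Z lam (linPart Z c d h)‖
      ≤ 2 * A * (√Z * (√(1 / (2 * lam)) * weightedNorm lam h)) := by
  have hA := hc.1.trans hc.2
  have e1 : ‖W Z lam (d1 h.fst)‖ ≤ √Z * (√(1 / (2 * lam)) * weightedNorm lam h) := by
    refine ((isWeakDeriv_d1 _).norm_W_le hZ hl (hasValueAt_d1_fst hh)).trans ?_
    gcongr
    exact norm_W_d2_fst_le lam h
  have e2 : ‖W Z lam (d1 (diffL Z h))‖ ≤ √Z * (√(1 / (2 * lam)) * weightedNorm lam h) := by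
    refine ((isWeakDeriv_d1 _).norm_W_le hZ hl (hasValueAt_d1_diffL hh)).trans ?_
    gcongr
    exact norm_W_d2_diffL_le lam h
  rw [linPart_apply, map_sub, map_neg, map_smul, map_smul]
  calc _ ≤ c * ‖W Z lam (d1 h.fst)‖ + d * ‖W Z lam (d1 (diffL Z h))‖ := by
        refine (norm_sub_le _ _).trans_eq ?_
        rw [norm_neg, norm_smul, norm_smul, Real.norm_of_nonneg hc.1, Real.norm_of_nonneg hd.1]
    _ ≤ A * (√Z * (√(1 / (2 * lam)) * weightedNorm lam h))
        + A * (√Z * (√(1 / (2 * lam)) * weightedNorm lam h)) := by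
        gcongr
        exacts [hc.2, hd.2]
    _ = _ := by ring

theorem norm_W_quadPart_right_le (hZ : 0 < Z) {lam A a b : ℝ} (hl : 0 < lam) (ha : a ∈ Icc 0 A)
    (hb : b ∈ Icc 0 A) (x : H2Pair Z) {h : H2Pair Z} (hh : h ∈ V Z) :
    ‖W Z lam (quadPart hZ a b x h)‖ ≤ 6 * sobolevConst Z * A * ‖x‖ *
      (√Z * (√(1 / (2 * lam)) * weightedNorm lam h)) := by
  have hA := ha.1.trans ha.2
  have hs := sobolevConst_nonneg Z
  have hn := weightedNorm_nonneg lam h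
  have e1 : ‖W Z lam (derivMul hZ x.fst (diffL Z h))‖ ≤ 2 * sobolevConst Z * ‖x‖ *
      (√Z * (√(1 / (2 * lam)) * weightedNorm lam h)) := by
    refine (norm_W_derivMul_le hZ hl _ (hasValueAt_d1_diffL hh)).trans ?_
    gcongr
    exacts [norm_fst_le x, norm_W_d2_diffL_le lam h]
  have e2 : ‖W Z lam (derivMul hZ (diffL Z x) (diffL Z h))‖ ≤
      2 * sobolevConst Z * (2 * ‖x‖) *
      (√Z * (√(1 / (2 * lam)) * weightedNorm lam h)) := by
    refine (norm_W_derivMul_le hZ hl _ (hasValueAt_d1_diffL hh)).trans ?_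
    gcongr
    exacts [norm_diffL_le x, norm_W_d2_diffL_le lam h]
  rw [quadPart_apply, map_add, map_smul, map_smul]
  refine (norm_add_le _ _).trans ?_
  rw [norm_smul, norm_smul, Real.norm_of_nonneg ha.1, Real.norm_of_nonneg hb.1]
  have f1 := mul_le_mul ha.2 e1 (norm_nonneg _) hA
  have f2 := mul_le_mul hb.2 e2 (norm_nonneg _) hA
  linarith

/-- `quadPart` is not symmetric, so this slot is treated separately: the products are commuted so
that the derivative of `h` becomes the weighted factor. -/
theorem norm_W_quadPart_left_le (hZ : 0 < Z) {lam A a b : ℝ} (hl : 0 < lam) (ha : a ∈ Icc 0 A)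
    (hb : b ∈ Icc 0 A) (x : H2Pair Z) {h : H2Pair Z} (hh : h ∈ V Z) :
    ‖W Z lam (quadPart hZ a b h x)‖ ≤ 8 * sobolevConst Z * A * ‖x‖ *
      (√Z * (√(1 / (2 * lam)) * weightedNorm lam h)) := by
  have hA := ha.1.trans ha.2
  have hs := sobolevConst_nonneg Z
  have hn := weightedNorm_nonneg lam h
  have e1 : ‖W Z lam (derivMul hZ (diffL Z x) h.fst)‖ ≤ 2 * sobolevConst Z * (2 * ‖x‖) *
      (√Z * (√(1 / (2 * lam)) * weightedNorm lam h)) := by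
    refine (norm_W_derivMul_le hZ hl _ (hasValueAt_d1_fst hh)).trans ?_
    gcongr
    exacts [norm_diffL_le x, norm_W_d2_fst_le lam h]
  have e2 : ‖W Z lam (derivMul hZ (diffL Z x) (diffL Z h))‖ ≤
      2 * sobolevConst Z * (2 * ‖x‖) *
      (√Z * (√(1 / (2 * lam)) * weightedNorm lam h)) := by
    refine (norm_W_derivMul_le hZ hl _ (hasValueAt_d1_diffL hh)).trans ?_
    gcongr
    exacts [norm_diffL_le x, norm_W_d2_diffL_le lam h]
  rw [quadPart_apply, map_add, map_smul, map_smul, derivMul_comm hZ h.fst,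
    derivMul_comm hZ (diffL Z h)]
  refine (norm_add_le _ _).trans ?_
  rw [norm_smul, norm_smul, Real.norm_of_nonneg ha.1, Real.norm_of_nonneg hb.1]
  have f1 := mul_le_mul ha.2 e1 (norm_nonneg _) hA
  have f2 := mul_le_mul hb.2 e2 (norm_nonneg _) hA
  linarith

theorem norm_W_W_quadPart_le (hZ : 0 < Z) {lam A a b : ℝ} (hl : 0 < lam) (ha : a ∈ Icc 0 A)
    (hb : b ∈ Icc 0 A) {h : H2Pair Z} (hh : h ∈ V Z) :
    ‖W Z lam (W Z lam (quadPart hZ a b h h))‖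
      ≤ 2 * A * (√Z * (1 / (2 * lam) * weightedNorm lam h ^ 2)) := by
  have hA := ha.1.trans ha.2
  have hn := weightedNorm_nonneg lam h
  have e : ∀ p : H2 Z, HasValueAt (d1 p) 0 0 → ‖W Z lam (d2 p)‖ ≤ weightedNorm lam h →
      ‖W Z lam (W Z lam (derivMul hZ p (diffL Z h)))‖
        ≤ √Z * (1 / (2 * lam) * weightedNorm lam h ^ 2) := by
    intro p hp hp'
    refine (norm_W_W_derivMul_le hZ hl hp (hasValueAt_d1_diffL hh)).trans ?_
    rw [pow_two]
    gcongr
    exact norm_W_d2_diffL_le lam h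
  have e1 := e _ (hasValueAt_d1_fst hh) (norm_W_d2_fst_le lam h)
  have e2 := e _ (hasValueAt_d1_diffL hh) (norm_W_d2_diffL_le lam h)
  rw [quadPart_apply, map_add, map_smul, map_smul, map_add, map_smul, map_smul]
  refine (norm_add_le _ _).trans ?_
  rw [norm_smul, norm_smul, Real.norm_of_nonneg ha.1, Real.norm_of_nonneg hb.1]
  have f1 := mul_le_mul ha.2 e1 (norm_nonneg _) hA
  have f2 := mul_le_mul hb.2 e2 (norm_nonneg _) hA
  linarith

/-- The constant that bounds the lower order terms in the convexity estimate. -/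
def lowerConst (Z R A : ℝ) : ℝ :=
  (√Z * A * (2 + 26 * sobolevConst Z * R)) ^ 2 / 2
    + 2 * (R + 3 * A * R + 12 * sobolevConst Z * A * R * R) * A * √Z

theorem remainder_ge (hZ : 0 < Z) {lam R A a b c d : ℝ} (hl : 0 < lam) (hR : 0 ≤ R)
    (ha : a ∈ Icc 0 A) (hb : b ∈ Icc 0 A) (hc : c ∈ Icc 0 A) (hd : d ∈ Icc 0 A)
    {P : H2Pair Z →L[ℝ] H2 Z} (hP : ∀ x, ‖P x‖ ≤ ‖x‖) {x h : H2Pair Z} (hx : ‖x‖ ≤ R)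
    (hh : h ∈ V Z) (hhR : ‖h‖ ≤ 2 * R) :
    ‖W Z lam (d2 (P h))‖ ^ 2 / 2 - lowerConst Z R A / lam * weightedNorm lam h ^ 2 ≤
      ‖quadMap (weightedLin Z lam c d P) (weightedQuad hZ lam a b) (x + h)‖ ^ 2
        - ‖quadMap (weightedLin Z lam c d P) (weightedQuad hZ lam a b) x‖ ^ 2
        - normSqQuadMapDeriv (weightedLin Z lam c d P) (weightedQuad hZ lam a b) x h := by
  have hA := ha.1.trans ha.2
  have hs := sobolevConst_nonneg Z
  have hn := weightedNorm_nonneg lam h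
  set τ := √(1 / (2 * lam)) with hτ
  have hτ2 : τ ^ 2 = 1 / (2 * lam) := Real.sq_sqrt (by positivity)
  have hτ0 : 0 ≤ τ := Real.sqrt_nonneg _
  set σ := weightedNorm lam h
  set K := linPart Z c d h + quadPart hZ a b x h + quadPart hZ a b h x + quadPart hZ a b h h
  -- The `2` comes from the linear part and `26 = 6 + 8 + 6 * 2` from the three quadratic ones. In
  -- the last of these one copy of `h` is estimated by `‖h‖ ≤ 2 * R`, which keeps the bound linear
  -- in `σ`.
  have hK : ‖W Z lam K‖ ≤ √Z * A * (2 + 26 * sobolevConst Z * R) * (τ * σ) := by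
    have e1 := norm_W_linPart_le hZ hl hc hd hh
    have e2 := norm_W_quadPart_right_le hZ hl ha hb x hh
    have e3 := norm_W_quadPart_left_le hZ hl ha hb x hh
    have e4 := norm_W_quadPart_right_le hZ hl ha hb h hh
    have e2' : ‖W Z lam (quadPart hZ a b x h)‖
        ≤ 6 * sobolevConst Z * A * R * (√Z * (τ * σ)) := e2.trans (by gcongr)
    have e3' : ‖W Z lam (quadPart hZ a b h x)‖
        ≤ 8 * sobolevConst Z * A * R * (√Z * (τ * σ)) := e3.trans (by gcongr)
    have e4' : ‖W Z lam (quadPart hZ a b h h)‖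
        ≤ 6 * sobolevConst Z * A * (2 * R) * (√Z * (τ * σ)) := e4.trans (by gcongr)
    simp only [K, map_add]
    refine (norm_add_le _ _).trans ((add_le_add_left norm_add₃_le _).trans ?_)
    linarith
  have hK2 : ‖W Z lam K‖ ^ 2
      ≤ (√Z * A * (2 + 26 * sobolevConst Z * R)) ^ 2 * (1 / (2 * lam) * σ ^ 2) := by
    refine (pow_le_pow_left₀ (norm_nonneg _) hK 2).trans_eq ?_
    rw [← hτ2]
    ring
  have hT : quadMapDeriv (weightedLin Z lam c d P) (weightedQuad hZ lam a b) x h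
      + weightedQuad hZ lam a b h h = W Z lam (d2 (P h)) + W Z lam K := by
    simp only [K, quadMapDeriv_apply, weightedLin_apply, weightedQuad_apply, map_add]
    abel
  set U := d2 (P x) + linPart Z c d x + quadPart hZ a b x x with hU
  have hUle : ‖U‖ ≤ R + 3 * A * R + 12 * sobolevConst Z * A * R * R := by
    refine norm_add₃_le.trans (add_le_add (add_le_add ?_ ?_) ?_)
    · exact (norm_d2_le _).trans ((hP x).trans hx)
    · exact (norm_linPart_le hc hd x).trans (by gcongr)
    · exact (norm_quadPart_le hZ ha hb x x).trans (by gcongr)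
  have hinner : -((R + 3 * A * R + 12 * sobolevConst Z * A * R * R)
      * (2 * A * (√Z * (1 / (2 * lam) * σ ^ 2))))
      ≤ inner ℝ (W Z lam U) (W Z lam (quadPart hZ a b h h)) := by
    -- With both weights on the quadratic term, the unweighted `U` is bounded independently of `λ`,
    -- and the other factor is `O(σ² / λ)`.
    rw [inner_W_W]
    have i1 := (abs_le.1 (abs_real_inner_le_norm U
      (W Z lam (W Z lam (quadPart hZ a b h h))))).1
    have i2 := mul_le_mul hUle (norm_W_W_quadPart_le hZ hl ha hb hh) (norm_nonneg _)
      (by positivity)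
    linarith
  rw [normSq_quadMap_add, hT, quadMap_weighted, weightedQuad_apply]
  have hmain := half_sq_sub_sq_le_norm_add_sq (W Z lam (d2 (P h))) (W Z lam K)
  have hconst : lowerConst Z R A / lam * σ ^ 2
      = (√Z * A * (2 + 26 * sobolevConst Z * R)) ^ 2 * (1 / (2 * lam) * σ ^ 2)
        + 2 * ((R + 3 * A * R + 12 * sobolevConst Z * A * R * R)
          * (2 * A * (√Z * (1 / (2 * lam) * σ ^ 2)))) := by
    unfold lowerConst
    field_simp
  linarith

theorem strong_convexity (hZ : 0 < Z) {R ε kmin kmax lam k : ℝ} (hR : 0 ≤ R) (hε : 0 < ε)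
    (hkmin : 0 < kmin) (hk : k ∈ Icc kmin kmax) (hl : 0 < lam)
    (hlam : 16 * lowerConst Z R (coeffBound ε kmin kmax) ≤ lam) {x y : H2Pair Z}
    (hx : ‖x‖ ≤ R) (hy : ‖y‖ ≤ R) (hxy : y - x ∈ V Z) :
    1 / (4 * (1 + Z ^ 2 + Z ^ 4)) * Real.exp (-2 * lam * Z) * ‖y - x‖ ^ 2 ≤
      J ε lam k y - J ε lam k x - derivJ hZ ε lam k x (y - x) := by
  obtain ⟨c1, c2, c3, c4⟩ := coeff_mem_Icc hε hkmin hk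
  set A := coeffBound ε kmin kmax
  obtain ⟨h, rfl⟩ : ∃ h, y = x + h := ⟨y - x, by abel⟩
  rw [add_sub_cancel_left] at hxy ⊢
  have hhR : ‖h‖ ≤ 2 * R := by
    have : ‖h‖ = ‖(x + h) - x‖ := by rw [add_sub_cancel_left]
    rw [this]
    linarith [norm_sub_le (x + h) x]
  have r1 := remainder_ge hZ hl hR c1 c2 c3 c4 (P := fstL Z) norm_fst_le hx hxy hhR
  have r2 := remainder_ge hZ hl hR c1 c2 c3 c4 (P := sndL Z) norm_snd_le hx hxy hhR
  -- Each of the two components loses at most `1/16` of `weightedNorm lam h ^ 2 ≤ 2 * (p ^ 2 + q ^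
  -- 2)`. The total loss is a quarter of `p ^ 2 + q ^ 2`, out of the available half.
  have hm : lowerConst Z R A / lam ≤ 1 / 16 := by
    rw [div_le_iff₀ hl]
    linarith
  rw [fstL_apply] at r1
  rw [sndL_apply] at r2
  set p := ‖W Z lam (d2 h.fst)‖
  set q := ‖W Z lam (d2 h.snd)‖
  have hσ : weightedNorm lam h ^ 2 ≤ 2 * (p ^ 2 + q ^ 2) := by
    have : weightedNorm lam h = p + q := rfl
    rw [this]
    nlinarith [sq_nonneg (p - q)]
  have hmσ : lowerConst Z R A / lam * weightedNorm lam h ^ 2 ≤ 1 / 16 * (2 * (p ^ 2 + q ^ 2)) :=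
    mul_le_mul hm hσ (sq_nonneg _) (by norm_num)
  have hJ : J ε lam k (x + h) - J ε lam k x - derivJ hZ ε lam k x h ≥ (p ^ 2 + q ^ 2) / 4 := by
    rw [J_eq hZ]
    simp only [partialJ, derivJ, add_apply]
    linarith
  have hexp : Real.exp (-2 * lam * Z) = Real.exp (-lam * Z) ^ 2 := by
    rw [← Real.exp_nat_mul]
    congr 1
    push_cast
    ring
  have hpoin : ∀ u : H2 Z, BoundaryCond u 0 0 0 →
      Real.exp (-2 * lam * Z) * ‖u‖ ^ 2 ≤ (1 + Z ^ 2 + Z ^ 4) * ‖W Z lam (d2 u)‖ ^ 2 := by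
    intro u hu
    have e1 := norm_sq_le_of_boundary hZ hu.1 hu.2.1
    have e2 := pow_le_pow_left₀ (by positivity) (exp_mul_norm_le_norm_W hl.le (d2 u)) 2
    rw [mul_pow, ← hexp] at e2
    calc _ ≤ Real.exp (-2 * lam * Z) * ((1 + Z ^ 2 + Z ^ 4) * ‖d2 u‖ ^ 2) := by gcongr
      _ = (1 + Z ^ 2 + Z ^ 4) * (Real.exp (-2 * lam * Z) * ‖d2 u‖ ^ 2) := by ring
      _ ≤ _ := by gcongr
  refine le_trans ?_ hJ
  have b1 := hpoin _ hxy.1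
  have b2 := hpoin _ hxy.2
  rw [H2Pair.norm_sq_eq]
  have hpos : 0 < 1 + Z ^ 2 + Z ^ 4 := by positivity
  calc 1 / (4 * (1 + Z ^ 2 + Z ^ 4)) * Real.exp (-2 * lam * Z) * (‖h.fst‖ ^ 2 + ‖h.snd‖ ^ 2)
      = 1 / (4 * (1 + Z ^ 2 + Z ^ 4)) * (Real.exp (-2 * lam * Z) * ‖h.fst‖ ^ 2
          + Real.exp (-2 * lam * Z) * ‖h.snd‖ ^ 2) := by ring
    _ ≤ 1 / (4 * (1 + Z ^ 2 + Z ^ 4)) * ((1 + Z ^ 2 + Z ^ 4) * p ^ 2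
          + (1 + Z ^ 2 + Z ^ 4) * q ^ 2) := by gcongr
    _ = _ := by field_simp

/-! ### Existence and uniqueness of the minimizer. -/

/-- A continuous function that is bounded below and uniformly convex at midpoints attains its
minimum on a nonempty closed convex subset of a complete space. -/
theorem exists_isMinOn_of_midpoint {E : Type*} [NormedAddCommGroup E] [NormedSpace ℝ E]
    [CompleteSpace E] {s : Set E} (hs : IsClosed s) (hconv : Convex ℝ s) (hne : s.Nonempty)
    {f : E → ℝ} (hf : Continuous f) (hf0 : ∀ x ∈ s, 0 ≤ f x) {c : ℝ} (hc : 0 < c)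
    (h : ∀ x ∈ s, ∀ y ∈ s, 2 * f (midpoint ℝ x y) + c * ‖x - y‖ ^ 2 ≤ f x + f y) :
    ∃ m ∈ s, IsMinOn f s m ∧ ∀ m' ∈ s, IsMinOn f s m' → m' = m := by
  have hbdd : BddBelow (f '' s) := ⟨0, by rintro _ ⟨x, hx, rfl⟩; exact hf0 x hx⟩
  set I := sInf (f '' s)
  have hI : ∀ x ∈ s, I ≤ f x := fun x hx => csInf_le hbdd ⟨x, hx, rfl⟩
  -- The value at the midpoint is at least `I`, so two nearly minimal points are close. This gives
  -- both the Cauchy property and uniqueness.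
  have hdist : ∀ x ∈ s, ∀ y ∈ s, c * ‖x - y‖ ^ 2 ≤ (f x - I) + (f y - I) := by
    intro x hx y hy
    have := hI _ (hconv.midpoint_mem hx hy)
    linarith [h x hx y hy]
  have hseq : ∀ n : ℕ, ∃ x ∈ s, f x < I + 1 / ((n : ℝ) + 1) := by
    intro n
    obtain ⟨_, ⟨x, hx, rfl⟩, hlt⟩ := exists_lt_of_csInf_lt (hne.image f)
      (lt_add_of_pos_right I (Nat.one_div_pos_of_nat (n := n) (α := ℝ)))
    exact ⟨x, hx, hlt⟩
  choose u hus huf using hseq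
  have hcau : CauchySeq u := by
    refine Metric.cauchySeq_iff'.2 fun δ hδ => ?_
    obtain ⟨n, hn⟩ := exists_nat_one_div_lt (show 0 < c * δ ^ 2 / 2 by positivity)
    refine ⟨n, fun j hj => ?_⟩
    have h1 := hdist _ (hus j) _ (hus n)
    have h2 : 1 / ((j : ℝ) + 1) ≤ 1 / ((n : ℝ) + 1) := by gcongr
    have h3 : c * ‖u j - u n‖ ^ 2 < c * δ ^ 2 := by linarith [huf j, huf n]
    rw [dist_eq_norm]
    exact lt_of_pow_lt_pow_left₀ 2 hδ.le (lt_of_mul_lt_mul_left h3 hc.le)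
  obtain ⟨m, hm⟩ := cauchySeq_tendsto_of_complete hcau
  have hms : m ∈ s := hs.mem_of_tendsto hm (Filter.Eventually.of_forall hus)
  have hmI : f m ≤ I := by
    have h1 : Filter.Tendsto (fun n : ℕ => I + 1 / ((n : ℝ) + 1)) Filter.atTop (nhds (I + 0)) :=
      tendsto_one_div_add_atTop_nhds_zero_nat.const_add I
    rw [add_zero] at h1
    exact le_of_tendsto_of_tendsto' ((hf.tendsto m).comp hm) h1 fun n => (huf n).le
  have hmin : IsMinOn f s m := fun x hx => hmI.trans (hI x hx)
  refine ⟨m, hms, hmin, fun m' hm' hmin' => ?_⟩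
  have h1 := hdist _ hm' _ hms
  have h2 : f m' ≤ f m := hmin' hms
  have h3 : c * ‖m' - m‖ ^ 2 ≤ c * 0 := by linarith
  have h4 := le_of_mul_le_mul_left h3 hc
  have h5 : ‖m' - m‖ = 0 := pow_eq_zero_iff two_ne_zero |>.1 (le_antisymm h4 (sq_nonneg _))
  exact sub_eq_zero.1 (norm_eq_zero.1 h5)

/-- Strong convexity is applied at the midpoint towards `x` and towards `y`. The increments are
opposite, so the derivative terms cancel, and two contributions `C / 4` remain. -/
theorem J_midpoint_le (hZ : 0 < Z) {R ε k lam C : ℝ} {g : ℝ → ℝ}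
    (h : ∀ x ∈ B Z ε R g k, ∀ y ∈ B Z ε R g k,
      C * ‖y - x‖ ^ 2 ≤ J ε lam k y - J ε lam k x - derivJ hZ ε lam k x (y - x))
    {x y : H2Pair Z} (hx : x ∈ B Z ε R g k) (hy : y ∈ B Z ε R g k) :
    2 * J ε lam k (midpoint ℝ x y) + C / 2 * ‖x - y‖ ^ 2 ≤ J ε lam k x + J ε lam k y := by
  have hm := (convex_B Z ε R k g).midpoint_mem hx hy
  have h1 := h _ hm _ hx
  have h2 := h _ hm _ hy
  have e1 : x - midpoint ℝ x y = (1 / 2 : ℝ) • (x - y) := by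
    rw [left_sub_midpoint]; norm_num
  have e2 : y - midpoint ℝ x y = -((1 / 2 : ℝ) • (x - y)) := by
    rw [right_sub_midpoint, ← smul_neg, neg_sub]; norm_num
  rw [e1, norm_smul, mul_pow] at h1
  rw [e2, norm_neg, norm_smul, mul_pow, map_neg] at h2
  norm_num at h1 h2
  linarith

theorem J_nonneg (ε lam k : ℝ) (x : H2Pair Z) : 0 ≤ J ε lam k x :=
  integral_nonneg fun _ => by positivity

end Convexification

end

open Convexification
theorem theorem5p1 (Z R ε kmin kmax : ℝ) (hZ : 0 < Z) (hR : 0 < R) (hε : 0 < ε)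
    (hkmin : 0 < kmin) (hk : kmin ≤ kmax) :
    -- (1) existence of the Fréchet derivative, and its Lipschitz continuity
    (∀ lam : ℝ, 0 < lam → ∀ k : ℝ, 0 < k → ∀ g : ℝ → ℝ, DifferentiableAt ℝ g k →
      ∀ x ∈ B Z ε R g k,
        ∃! G : V Z, IsFrechetDeriv ε lam k x G) ∧
    (∀ lam : ℝ, 0 < lam → ∃ D : ℝ, 0 < D ∧
      ∀ k ∈ Set.Icc kmin kmax, ∀ g : ℝ → ℝ, DifferentiableAt ℝ g k →
      ∀ x₁ ∈ B Z ε R g k, ∀ x₂ ∈ B Z ε R g k,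
      ∀ G₁ G₂ : V Z,
        IsFrechetDeriv ε lam k x₁ G₁ →
        IsFrechetDeriv ε lam k x₂ G₂ →
          ‖G₂ - G₁‖ ≤ D * ‖x₂ - x₁‖) ∧
    ∃ lam₁ C₁ : ℝ, 1 ≤ lam₁ ∧ 0 < C₁ ∧
      ∀ lam : ℝ, lam₁ ≤ lam → ∀ k ∈ Set.Icc kmin kmax,
      ∀ g : ℝ → ℝ, DifferentiableAt ℝ g k →
        -- (2) strong convexity
        (∀ x₁ ∈ B Z ε R g k, ∀ x₂ ∈ B Z ε R g k,
          ∀ G : V Z, IsFrechetDeriv ε lam k x₁ G →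
            C₁ * Real.exp (-2 * lam * Z) * ‖x₂ - x₁‖ ^ 2 ≤
              J ε lam k x₂ - J ε lam k x₁
                - inner ℝ (G : H2Pair Z) (x₂ - x₁)) ∧
        -- (3) existence and uniqueness of the minimizer, and the variational inequality
        ((B Z ε R g k).Nonempty →
          ∃ m ∈ B Z ε R g k,
            IsMinOn (J ε lam k) (B Z ε R g k) m ∧
            (∀ m' ∈ B Z ε R g k,
              IsMinOn (J ε lam k) (B Z ε R g k) m' → m' = m) ∧
            ∀ G : V Z, IsFrechetDeriv ε lam k m G →
              ∀ x ∈ B Z ε R g k,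
                0 ≤ inner ℝ (G : H2Pair Z) (x - m)) := by
  refine ⟨fun lam _ k _ g _ x _ => existsUnique_isFrechetDeriv hZ ε lam k x, ?_, ?_⟩
  · intro lam hl
    obtain ⟨D, hD, hlip⟩ := exists_lipschitz hZ hR hε hkmin hk hl
    refine ⟨D, hD, fun k hk g _ x₁ hx₁ x₂ hx₂ G₁ G₂ h₁ h₂ => ?_⟩
    -- Testing with `G₂ - G₁` itself turns the left side into `‖G₂ - G₁‖ ^ 2`; one factor is then
    -- cancelled unless it is zero.
    have h := hlip k hk x₁ x₂ (norm_le_of_mem_B hx₁) (norm_le_of_mem_B hx₂)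
      (G₂ - G₁ : V Z)
    rw [← h₂.inner_eq hZ (G₂ - G₁).2, ← h₁.inner_eq hZ (G₂ - G₁).2, ← inner_sub_left,
      ← Submodule.coe_sub, real_inner_self_eq_norm_sq, pow_two, ← Submodule.coe_norm] at h
    rcases (norm_nonneg (G₂ - G₁)).eq_or_lt with h0 | h0
    · rw [← h0]
      positivity
    · exact le_of_mul_le_mul_right h h0
  · refine ⟨max 1 (16 * lowerConst Z R (coeffBound ε kmin kmax)),
      1 / (4 * (1 + Z ^ 2 + Z ^ 4)), le_max_left _ _, by positivity, ?_⟩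
    intro lam hlam k hk g _
    have hl : 0 < lam := one_pos.trans_le ((le_max_left _ _).trans hlam)
    have hl' := (le_max_right _ _).trans hlam
    have key : ∀ x ∈ B Z ε R g k, ∀ y ∈ B Z ε R g k,
        1 / (4 * (1 + Z ^ 2 + Z ^ 4)) * Real.exp (-2 * lam * Z) * ‖y - x‖ ^ 2 ≤
          J ε lam k y - J ε lam k x - derivJ hZ ε lam k x (y - x) := fun x hx y hy =>
      strong_convexity hZ hR.le hε hkmin hk hl hl' (norm_le_of_mem_B hx) (norm_le_of_mem_B hy)
        (sub_mem_V hy hx)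
    refine ⟨fun x₁ hx₁ x₂ hx₂ G hG => ?_, fun hne => ?_⟩
    · rw [hG.inner_eq hZ (sub_mem_V hx₂ hx₁)]
      exact key x₁ hx₁ x₂ hx₂
    · have hcont : Continuous (J (Z := Z) ε lam k) :=
        continuous_iff_continuousAt.2 fun x => (hasFDerivAt_J hZ ε lam k x).continuousAt
      obtain ⟨m, hm, hmin, huniq⟩ := exists_isMinOn_of_midpoint (isClosed_B hZ g)
        (convex_B Z ε R k g) hne hcont (fun x _ => J_nonneg ε lam k x)
        (c := 1 / (4 * (1 + Z ^ 2 + Z ^ 4)) * Real.exp (-2 * lam * Z) / 2) (by positivity)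
        fun x hx y hy => J_midpoint_le hZ key hx hy
      refine ⟨m, hm, hmin, huniq, fun G hG x hx => ?_⟩
      rw [hG.inner_eq hZ (sub_mem_V hx hm)]
      -- The segment from `m` to `x` stays in the convex set `B`, so `x - m` is an admissible
      -- direction, along which the derivative at a minimum is nonnegative.
      exact hmin.localize.hasFDerivWithinAt_nonneg
        (hasFDerivAt_J hZ ε lam k m).hasFDerivWithinAt
        (sub_mem_posTangentConeAt_of_segment_subset ((convex_B Z ε R k g).segment_subset hm hx))
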